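/- Let $K$ be an algebraically closed field of characteristic zero (for example $K=\mathbb C$). The index of a finite-dimensional Lie algebra $\mathfrak g$ over $K$ is $$\operatorname{ind}\mathfrak g=\min_{f\in\mathfrak g^*}\dim\ker(B_f),\qquad B_f(x,y)=f([x,y]).$$ Let $n$ be a positive integer and let $e_1,\dots,e_n$ be the standard basis of $K^n$. For compositions $\boldsymbol a=(a_1,\dots,a_m)$ and $\boldsymbol b=(b_1,\dots,b_t)$ of $n$ (sequences of positive integers with sum $n$), the seaweed subalgebra of $\mathfrak{sl}(n)=\mathfrak{sl}(n,K)$ with parametrizing pair $(\boldsymbol a,\boldsymbol b)$ is the Lie algebra of all traceless $n\times n$ matrices that preserve each of the subspaces $V_i=\operatorname{span}\{e_1,\dots,e_{a_1+\cdots+a_i}\}$ $(0\le i\le m)$ and $W_j=\operatorname{span}\{e_{b_1+\cdots+b_j+1},\dots,e_n\}$ $(0\le j\le t)$. Let $C(n,k)$ denote the number of ordered pairs $(\boldsymbol a,\boldsymbol b)$ of compositions of $n$ whose seaweed subalgebra of $\mathfrak{sl}(n)$ has index $k$. **Theorem.** For every integer $n\ge 3$, $$C(n,n-3)=\begin{cases}(7n-15)\,2^{n-3},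 & 3\le n\le 5,\\[2pt] \left(\tfrac12 n^2+\tfrac{11}{4}n-\tfrac{25}{4}\right)2^{n-3}, & n\ge 5.\end{cases}$$ -/

import Mathlib

namespace Seaweed

/-- The Kirillov form `B_f(x, y) = f([x, y])` of a linear form `f` on a Lie algebra `L`. -/
def kirillovForm {K L : Type*} [CommRing K] [LieRing L] [LieAlgebra K L]
    (f : Module.Dual K L) : L →ₗ[K] L →ₗ[K] K :=
  LinearMap.mk₂ K (fun x y => f ⁅x, y⁆)
    (fun x x' y => by simp) (fun c x y => by simp)
    (fun x y y' => by simp) (fun c x y => by simp)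

/-- The index of a finite-dimensional Lie algebra `L` over `K`: the minimum, over all linear
forms `f` on `L`, of the dimension of the kernel of the Kirillov form `B_f`. (The infimum is
that of a nonempty set of natural numbers, so it is attained.) -/
noncomputable def lieIndex (K L : Type*) [Field K] [LieRing L] [LieAlgebra K L] : ℕ :=
  ⨅ f : Module.Dual K L, Module.finrank K (LinearMap.ker (kirillovForm f))

/-- `V_i = span {e_1, …, e_{a_1 + ⋯ + a_i}}`, for a composition `a` of `n`. -/
def flagV (K : Type*) [Field K] {n : ℕ} (a : Composition n) (i : ℕ) :
    Submodule K (Fin n → K) :=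
  Submodule.span K ((fun j : Fin n => (Pi.single j 1 : Fin n → K)) ''
    {j | (j : ℕ) < a.sizeUpTo i})

/-- `W_i = span {e_{b_1 + ⋯ + b_i + 1}, …, e_n}`, for a composition `b` of `n`. -/
def flagW (K : Type*) [Field K] {n : ℕ} (b : Composition n) (i : ℕ) :
    Submodule K (Fin n → K) :=
  Submodule.span K ((fun j : Fin n => (Pi.single j 1 : Fin n → K)) ''
    {j | b.sizeUpTo i ≤ (j : ℕ)})

/-- The subspace `U` is preserved by the matrix `x`, acting on column vectors. -/
def Preserves {K : Type*} [Field K] {n : ℕ} (x : Matrix (Fin n) (Fin n) K)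
    (U : Submodule K (Fin n → K)) : Prop :=
  ∀ v ∈ U, x.mulVec v ∈ U

/-- The seaweed subalgebra of `sl(n)` of type `a_1|⋯|a_m / b_1|⋯|b_t`: the traceless matrices
that preserve all the members of the two flags attached to the compositions `a`, `b`. -/
def seaweed (K : Type*) [Field K] {n : ℕ} (a b : Composition n) :
    LieSubalgebra K (LieAlgebra.SpecialLinear.sl (Fin n) K) where
  carrier := {x |
    (∀ i ≤ a.length, Preserves (x : Matrix (Fin n) (Fin n) K) (flagV K a i)) ∧
    (∀ i ≤ b.length, Preserves (x : Matrix (Fin n) (Fin n) K) (flagW K b i))}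
  add_mem' := by
    rintro x y ⟨hx, hx'⟩ ⟨hy, hy'⟩
    refine ⟨fun i hi v hv => ?_, fun i hi v hv => ?_⟩
    · simpa [Matrix.add_mulVec] using add_mem (hx i hi v hv) (hy i hi v hv)
    · simpa [Matrix.add_mulVec] using add_mem (hx' i hi v hv) (hy' i hi v hv)
  zero_mem' := by
    refine ⟨fun i _ v _ => ?_, fun i _ v _ => ?_⟩ <;> simp
  smul_mem' := by
    rintro c x ⟨hx, hx'⟩
    refine ⟨fun i hi v hv => ?_, fun i hi v hv => ?_⟩
    · simpa [Matrix.smul_mulVec] using Submodule.smul_mem _ c (hx i hi v hv)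
    · simpa [Matrix.smul_mulVec] using Submodule.smul_mem _ c (hx' i hi v hv)
  lie_mem' := by
    rintro x y ⟨hx, hx'⟩ ⟨hy, hy'⟩
    refine ⟨fun i hi v hv => ?_, fun i hi v hv => ?_⟩
    · simpa [Ring.lie_def, Matrix.sub_mulVec, Matrix.mulVec_mulVec] using
        sub_mem (hx i hi _ (hy i hi v hv)) (hy i hi _ (hx i hi v hv))
    · simpa [Ring.lie_def, Matrix.sub_mulVec, Matrix.mulVec_mulVec] using
        sub_mem (hx' i hi _ (hy' i hi v hv)) (hy' i hi _ (hx' i hi v hv))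

/-- `C(n, k)`: the number of ordered pairs of compositions of `n` whose seaweed subalgebra of
`sl(n)` (over `K`) has index `k`. -/
noncomputable def C (K : Type*) [Field K] (n k : ℕ) : ℕ :=
  Set.ncard {p : Composition n × Composition n | lieIndex K (seaweed K p.1 p.2) = k}

end Seaweed

/-! Adding the scalar matrices to a seaweed in sl(n) raises its index by exactly one
(`finrank_radical_eq_finrank_ker_add_one`), so the index can be computed in the associative algebra
of matrices supported on `seaRel`.

There the meander reduction is proved. If the first parts are a < b, the a × (b - a) corner V of the
larger block is an abelian ideal. When a linear form is an identity pattern on V, V is isotropic,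
its orthogonal is V plus a copy of a smaller seaweed, and a dimension count identifies the
dimensions of the two radicals (`finrank_radical_reduction`, `IsReduction.finrank_radical_eq`). An
arbitrary form reaches this shape by a generic perturbation, which cannot enlarge the radical,
followed by conjugations (`IsReduction.exists_std`). Equal first parts a split off gl(a), whose
index is a (`hasIndex_blockRel`). Hence the gl index is n minus the total size removed by reduction
steps. This total is the `Defect`, and sl index n - 3 means defect 2.

Since every reduction step removes a positive size, defect 0 forces equal lists, and defects 1 and 2
allow only a few shapes (`defect_one_iff`, `defect_two_iff`). Let E(n) and L(n) count the defect-two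
pairs with equal first parts and with smaller first part on the left. By symmetry the total is E(n)
+ 2 L(n), and removing or lowering a common first part gives E(n+1) = 2 E(n) + 2 L(n). The shapes
express L(n) through numbers of compositions and of defect-one pairs whose second list has first or
second part 1. The number of compositions of k is 2^(k-1) only for k > 0 and is 1 for k = 0; such
boundary values cause the different formula for small n. -/

namespace Seaweed

/-! ### Radicals of commutator forms: reduction, transport, semicontinuity. -/

open Module Filter

/-- The radical, inside a subspace `q` of an associative algebra, of the form
`(x, y) ↦ f (x * y - y * x)`. -/
def radical {K A : Type*} [Field K] [Ring A] [Algebra K A] (q : Submodule K A)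
    (f : A →ₗ[K] K) : Submodule K A where
  carrier := {x | x ∈ q ∧ ∀ y ∈ q, f (x * y - y * x) = 0}
  add_mem' := by
    rintro x y ⟨hx, hx'⟩ ⟨hy, hy'⟩
    refine ⟨add_mem hx hy, fun z hz => ?_⟩
    have h : (x + y) * z - z * (x + y) = (x * z - z * x) + (y * z - z * y) := by noncomm_ring
    rw [h, map_add, hx' z hz, hy' z hz, add_zero]
  zero_mem' := ⟨zero_mem _, fun z _ => by simp⟩
  smul_mem' := by
    rintro c x ⟨hx, hx'⟩
    refine ⟨Submodule.smul_mem _ c hx, fun z hz => ?_⟩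
    rw [smul_mul_assoc, mul_smul_comm, ← smul_sub, map_smul, hx' z hz, smul_zero]

/-- The minimal dimension of the radicals of the forms `(x, y) ↦ f (x * y - y * x)` on `q`
is `k`. -/
def HasIndex {K A : Type*} [Field K] [Ring A] [Algebra K A] (q : Submodule K A) (k : ℕ) : Prop :=
  (∃ f : A →ₗ[K] K, finrank K (radical q f) ≤ k) ∧
    ∀ f : A →ₗ[K] K, k ≤ finrank K (radical q f)

section

variable {K A : Type*} [Field K] [Ring A] [Algebra K A]

lemma mem_radical {q : Submodule K A} {f : A →ₗ[K] K} {x : A} :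
    x ∈ radical q f ↔ x ∈ q ∧ ∀ y ∈ q, f (x * y - y * x) = 0 := Iff.rfl

/-- The form `(x, y) ↦ f (x * y - y * x)`. -/
def commForm (f : A →ₗ[K] K) : A →ₗ[K] A →ₗ[K] K :=
  (LinearMap.mul K A - (LinearMap.mul K A).flip).compr₂ f

@[simp] lemma commForm_apply (f : A →ₗ[K] K) (x y : A) :
    commForm f x y = f (x * y - y * x) := rfl

lemma commForm_neg_swap (f : A →ₗ[K] K) (x y : A) : f (x * y - y * x) = - f (y * x - x * y) := by
  rw [← map_neg, neg_sub]

/-- Reduction of the radical along an isotropic subspace `V` whose orthogonal is `V ⊕ s`. -/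
theorem finrank_radical_reduction [FiniteDimensional K A] {q V s : Submodule K A} {f : A →ₗ[K] K}
    (hV : V ≤ q) (hs : s ≤ q)
    (hVV : ∀ v ∈ V, ∀ w ∈ V, f (v * w - w * v) = 0)
    (hVs : ∀ v ∈ V, ∀ w ∈ s, f (v * w - w * v) = 0)
    (hdisj : Disjoint V s)
    (hnd : ∀ v ∈ V, (∀ y ∈ q, f (v * y - y * v) = 0) → v = 0)
    (hperp : ∀ x ∈ q, (∀ v ∈ V, f (v * x - x * v) = 0) → x ∈ V ⊔ s) :
    finrank K (radical q f) = finrank K (radical s f) := by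
  let B : LinearMap.BilinForm K q := (commForm f).domRestrict₁₂ q q
  have hB : ∀ x y : q, B x y = f (x * y - y * x) := fun x y => rfl
  have hrefl : B.IsRefl := by
    intro x y h
    rw [hB] at h ⊢
    rw [commForm_neg_swap, h, neg_zero]
  let V' : Submodule K q := V.comap q.subtype
  have hVmap : V'.map q.subtype = V := by
    rw [Submodule.map_comap_subtype, inf_eq_right.mpr hV]
  have hfin : ∀ W : Submodule K q, finrank K (W.map q.subtype) = finrank K W := fun W =>
    (LinearEquiv.finrank_eq (Submodule.equivMapOfInjective _ q.subtype_injective _)).symm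
  have hrad : (B.orthogonal ⊤).map q.subtype = radical q f := by
    ext x
    simp only [Submodule.mem_map, LinearMap.BilinForm.mem_orthogonal_iff, mem_radical]
    constructor
    · rintro ⟨x, hx, rfl⟩
      refine ⟨x.2, fun y hy => ?_⟩
      have := hx ⟨y, hy⟩ trivial
      rw [hB] at this
      rw [commForm_neg_swap, neg_eq_zero]; exact this
    · rintro ⟨hx, hx'⟩
      refine ⟨⟨x, hx⟩, fun y _ => ?_, rfl⟩
      rw [hB, commForm_neg_swap, neg_eq_zero]
      exact hx' y y.2
  have horth : (B.orthogonal V').map q.subtype = V ⊔ s := by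
    ext x
    simp only [Submodule.mem_map, LinearMap.BilinForm.mem_orthogonal_iff]
    constructor
    · rintro ⟨x, hx, rfl⟩
      exact hperp x x.2 fun v hv => hx ⟨v, hV hv⟩ hv
    · intro hx
      obtain ⟨v, hv, w, hw, rfl⟩ := Submodule.mem_sup.mp hx
      refine ⟨⟨v + w, add_mem (hV hv) (hs hw)⟩, fun u hu => ?_, rfl⟩
      rw [hB]
      have h1 := hVV u hu v hv
      have h2 := hVs u hu w hw
      have h : (u : A) * (v + w) - (v + w) * u = (u * v - v * u) + (u * w - w * u) := by
        noncomm_ring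
      simp only [h, map_add, h1, h2, add_zero]
  -- An element orthogonal to V ⊔ s is orthogonal to V, so it lies in V ⊔ s itself; as V pairs to
  -- zero with V and s, the only remaining condition is that its s-component be in the radical of s.
  have horth2 : (B.orthogonal (B.orthogonal V')).map q.subtype = V ⊔ radical s f := by
    have key : ∀ x : q, x ∈ B.orthogonal (B.orthogonal V') ↔
        ∀ y ∈ V ⊔ s, f (y * x - x * y) = 0 := by
      intro x
      rw [LinearMap.BilinForm.mem_orthogonal_iff, ← horth]
      constructor
      · rintro h _ ⟨y, hy, rfl⟩
        exact h y hy
      · intro h y hy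
        exact h y ⟨y, hy, rfl⟩
    ext x
    simp only [Submodule.mem_map]
    constructor
    · rintro ⟨x, hx, rfl⟩
      rw [key] at hx
      obtain ⟨v, hv, w, hw, hvw⟩ := Submodule.mem_sup.mp
        (hperp x x.2 fun v hv => hx v (Submodule.mem_sup_left hv))
      refine Submodule.mem_sup.mpr ⟨v, hv, w, ⟨hw, fun y hy => ?_⟩, hvw⟩
      have h1 := hx y (Submodule.mem_sup_right hy)
      rw [← hvw] at h1
      have h2 := hVs v hv y hy
      have h : w * y - y * w = -(y * (v + w) - (v + w) * y) - (v * y - y * v) := by noncomm_ring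
      rw [h, map_sub, map_neg, h1, h2]; simp
    · intro hx
      obtain ⟨v, hv, w, hw, rfl⟩ := Submodule.mem_sup.mp hx
      refine ⟨⟨v + w, add_mem (hV hv) (hs hw.1)⟩, (key _).mpr fun y hy => ?_, rfl⟩
      obtain ⟨v', hv', w', hw', rfl⟩ := Submodule.mem_sup.mp hy
      have h : (v' + w') * (v + w) - (v + w) * (v' + w') =
        (v' * v - v * v') + (v' * w - w * v') - (v * w' - w' * v) - (w * w' - w' * w) := by
        noncomm_ring
      simp only [h, map_add, map_sub, hVV v' hv' v hv, hVs v' hv' w hw.1, hVs v hv w' hw',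
        hw.2 w' hw']
      simp
  -- Since V meets the radical trivially, dim V + dim V^⊥ = dim q; and dim V^⊥ + dim V^⊥⊥ = dim q +
  -- dim rad(q). With V^⊥⊥ = V ⊕ rad(s) the two equations give dim rad(q) = dim rad(s).
  have e1 := LinearMap.BilinForm.finrank_add_finrank_orthogonal hrefl V'
  have e2 := LinearMap.BilinForm.finrank_add_finrank_orthogonal hrefl (B.orthogonal V')
  have i1 : V' ⊓ B.orthogonal ⊤ = ⊥ := by
    rw [eq_bot_iff]
    rintro x ⟨hx, hx'⟩
    have h : (x : A) ∈ radical q f := hrad ▸ ⟨x, hx', rfl⟩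
    exact Subtype.ext (hnd x hx h.2)
  have i2 : B.orthogonal V' ⊓ B.orthogonal ⊤ = B.orthogonal ⊤ :=
    inf_eq_right.mpr (LinearMap.BilinForm.orthogonal_le le_top)
  rw [i1, finrank_bot] at e1
  rw [i2] at e2
  have e3 : finrank K (V ⊔ radical s f : Submodule K A) = finrank K V + finrank K (radical s f) := by
    have := Submodule.finrank_sup_add_finrank_inf_eq V (radical s f)
    have hd : V ⊓ radical s f = ⊥ :=
      eq_bot_iff.mpr fun x hx => (Submodule.disjoint_def.mp hdisj x hx.1 hx.2.1)
    rwa [hd, finrank_bot, add_zero] at this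
  rw [← horth2, hfin, ← hVmap, hfin] at e3
  rw [← hrad, hfin]
  omega

/-- Transport of radicals along a linear map that is multiplicative and injective on `q`. -/
theorem finrank_radical_map {B : Type*} [Ring B] [Algebra K B] {q : Submodule K B} (θ : B →ₗ[K] A)
    (hmul : ∀ x ∈ q, ∀ y ∈ q, θ (x * y) = θ x * θ y)
    (hinj : ∀ x ∈ q, θ x = 0 → x = 0) (f : A →ₗ[K] K) :
    finrank K (radical (q.map θ) f) = finrank K (radical q (f ∘ₗ θ)) := by
  have h : radical (q.map θ) f = (radical q (f ∘ₗ θ)).map θ := by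
    ext x
    constructor
    · rintro ⟨⟨x, hx, rfl⟩, hx'⟩
      refine ⟨x, ⟨hx, fun y hy => ?_⟩, rfl⟩
      rw [LinearMap.comp_apply, map_sub, hmul x hx y hy, hmul y hy x hx]
      exact hx' _ ⟨y, hy, rfl⟩
    · rintro ⟨x, ⟨hx, hx'⟩, rfl⟩
      refine ⟨⟨x, hx, rfl⟩, ?_⟩
      rintro _ ⟨y, hy, rfl⟩
      rw [← hmul x hx y hy, ← hmul y hy x hx, ← map_sub]
      exact hx' y hy
  rw [h]
  have hi : Function.Injective (θ.domRestrict (radical q (f ∘ₗ θ))) := by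
    rw [← LinearMap.ker_eq_bot, eq_bot_iff]
    rintro ⟨x, hx⟩ h0
    exact Subtype.ext (hinj x hx.1 h0)
  rw [← LinearMap.finrank_range_of_inj hi, LinearMap.range_domRestrict]

/-- Closure under products keeps the commutators inside `q`, so only the values of the form on `q`
matter. -/
lemma radical_congr {q : Submodule K A} {f g : A →ₗ[K] K}
    (hmul : ∀ x ∈ q, ∀ y ∈ q, x * y ∈ q) (h : ∀ x ∈ q, f x = g x) :
    radical q f = radical q g := by
  ext x
  simp only [mem_radical]
  refine and_congr_right fun hx => forall₂_congr fun y hy => ?_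
  rw [h _ (sub_mem (hmul x hx y hy) (hmul y hy x hx))]

/-- Semicontinuity of the dimension of the kernel. -/
theorem eventually_finrank_ker_le {V W : Type*} [AddCommGroup V] [Module K V]
    [FiniteDimensional K V] [AddCommGroup W] [Module K W] (S T : V →ₗ[K] W) :
    ∀ᶠ t : K in cofinite, finrank K (LinearMap.ker (t • S + T)) ≤ finrank K (LinearMap.ker S) := by
  obtain ⟨C, hC⟩ := Submodule.exists_isCompl (LinearMap.ker S)
  have hinj : LinearMap.ker (S.domRestrict C) = ⊥ := by
    rw [eq_bot_iff]
    rintro ⟨x, hx⟩ h0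
    exact Subtype.ext (Submodule.disjoint_def.mp hC.disjoint x h0 hx)
  obtain ⟨L, hL⟩ := LinearMap.exists_leftInverse_of_injective _ hinj
  -- A vector of C killed by t • S + T satisfies X x = -t x, because L inverts S on C. So C meets
  -- that kernel nontrivially only when -t is one of the finitely many eigenvalues of X.
  let X : End K C := L ∘ₗ T.domRestrict C
  have hfin : {t : K | X.HasEigenvalue (-t)}.Finite :=
    (Module.End.finite_hasEigenvalue X).preimage neg_injective.injOn
  refine (hfin.compl_mem_cofinite : _) |> Filter.mem_of_superset <| ?_
  intro t ht
  have hd : C ⊓ LinearMap.ker (t • S + T) = ⊥ := by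
    rw [eq_bot_iff]
    rintro x ⟨hx, hx'⟩
    by_contra hne
    apply ht
    refine Module.End.hasEigenvalue_of_hasEigenvector (x := ⟨x, hx⟩) ⟨?_, ?_⟩
    · rw [Module.End.mem_eigenspace_iff]
      have h1 : L (S x) = ⟨x, hx⟩ := LinearMap.congr_fun hL ⟨x, hx⟩
      have h2 : t • S x + T x = 0 := hx'
      have h3 : t • L (S x) + L (T x) = 0 := by rw [← map_smul, ← map_add, h2, map_zero]
      rw [h1] at h3
      have : X ⟨x, hx⟩ = L (T x) := rfl
      rw [this, neg_smul]
      exact eq_neg_of_add_eq_zero_right h3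
    · intro h
      exact hne (congrArg Subtype.val h)
  have e1 := Submodule.finrank_sup_add_finrank_inf_eq C (LinearMap.ker (t • S + T))
  have e2 : finrank K (LinearMap.ker S) + finrank K C = finrank K V :=
    Submodule.finrank_add_eq_of_isCompl hC
  rw [hd, finrank_bot] at e1
  have e3 : finrank K (C ⊔ LinearMap.ker (t • S + T) : Submodule K V) ≤ finrank K V :=
    Submodule.finrank_le _
  change finrank K (LinearMap.ker (t • S + T)) ≤ finrank K (LinearMap.ker S)
  omega

/-- This allows any form to be replaced by a generic member of a pencil through it when bounding its
radical from below. -/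
theorem eventually_finrank_radical_le [FiniteDimensional K A] (q : Submodule K A)
    (f g : A →ₗ[K] K) :
    ∀ᶠ t : K in cofinite,
      finrank K (radical q (t • f + g)) ≤ finrank K (radical q f) := by
  have h : ∀ f : A →ₗ[K] K, radical q f =
      (LinearMap.ker ((commForm f).domRestrict₁₂ q q)).map q.subtype := by
    intro f
    ext x
    simp only [mem_radical, Submodule.mem_map, LinearMap.mem_ker]
    constructor
    · rintro ⟨hx, hx'⟩
      exact ⟨⟨x, hx⟩, LinearMap.ext fun y => hx' y y.2, rfl⟩
    · rintro ⟨x, hx, rfl⟩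
      exact ⟨x.2, fun y hy => LinearMap.congr_fun hx ⟨y, hy⟩⟩
  have h' : ∀ f : A →ₗ[K] K, finrank K (radical q f) =
      finrank K (LinearMap.ker ((commForm f).domRestrict₁₂ q q)) := fun f => by
    rw [h f]
    exact (LinearEquiv.finrank_eq (Submodule.equivMapOfInjective _ q.subtype_injective _)).symm
  filter_upwards [eventually_finrank_ker_le ((commForm f).domRestrict₁₂ q q)
    ((commForm g).domRestrict₁₂ q q)] with t ht
  rw [h', h']
  have hadd : (commForm (t • f + g)).domRestrict₁₂ q q =
      t • (commForm f).domRestrict₁₂ q q + (commForm g).domRestrict₁₂ q q := by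
    ext x y
    rfl
  rw [hadd]
  exact ht

/-- Radicals are transported by inner automorphisms preserving `q`. -/
theorem finrank_radical_conj {q : Submodule K A} {u v : A} (huv : u * v = 1) (hvu : v * u = 1)
    (h1 : ∀ x ∈ q, v * x * u ∈ q) (h2 : ∀ x ∈ q, u * x * v ∈ q) (f : A →ₗ[K] K) :
    finrank K (radical q (f ∘ₗ LinearMap.mulLeft K v ∘ₗ LinearMap.mulRight K u)) =
      finrank K (radical q f) := by
  have hθ : ∀ x, (LinearMap.mulLeft K v ∘ₗ LinearMap.mulRight K u) x = v * x * u := fun x => by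
    simp [mul_assoc]
  rw [← finrank_radical_map]
  · have hq : q.map (LinearMap.mulLeft K v ∘ₗ LinearMap.mulRight K u) = q := by
      ext x
      constructor
      · rintro ⟨y, hy, rfl⟩
        rw [hθ]; exact h1 y hy
      intro hx
      refine ⟨_, h2 x hx, ?_⟩
      rw [hθ]
      calc v * (u * x * v) * u = (v * u) * x * (v * u) := by noncomm_ring
        _ = x := by rw [hvu, one_mul, mul_one]
    rw [hq]
  · intro x _ y _
    simp only [hθ]
    calc v * (x * y) * u = v * x * 1 * y * u := by noncomm_ring
      _ = v * x * (u * v) * y * u := by rw [huv]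
      _ = _ := by noncomm_ring
  · intro x _ h
    rw [hθ] at h
    calc x = (u * v) * x * (u * v) := by rw [huv, one_mul, mul_one]
      _ = u * (v * x * u) * v := by noncomm_ring
      _ = 0 := by rw [h]; simp

/-- The determinant is a polynomial in t with value 1 at t = 0, hence has finitely many roots. -/
theorem eventually_isUnit_one_add_smul {ι : Type*} [Fintype ι] [DecidableEq ι]
    (X : Matrix ι ι K) : ∀ᶠ t : K in cofinite, IsUnit (1 + t • X) := by
  let p : Polynomial K := (1 + (Polynomial.X : Polynomial K) • X.map Polynomial.C).det
  have hp : ∀ t, p.eval t = (1 + t • X).det := by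
    intro t
    have : (1 + t • X) = (Polynomial.evalRingHom t).mapMatrix
        (1 + (Polynomial.X : Polynomial K) • X.map Polynomial.C) := by
      ext i j
      by_cases h : i = j <;> simp [h, mul_comm (X _ _)]
    rw [this, ← RingHom.map_det]
    rfl
  have hp0 : p ≠ 0 := by
    intro h
    have := hp 0
    simp [h] at this
  classical
  refine Filter.mem_of_superset (p.roots.toFinset.finite_toSet.compl_mem_cofinite) ?_
  intro t ht
  rw [Set.mem_ofPred_eq, Matrix.isUnit_iff_isUnit_det, ← hp, isUnit_iff_ne_zero]
  intro h
  exact ht (by simpa [hp0] using h)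

end


/-! ### Matrix spaces cut out by a relation on the indices. -/

open Module Filter Matrix

/-- The matrices whose nonzero entries sit at positions `(i, j)` with `R i j`. -/
def suppMat (K : Type*) [Field K] {ι : Type*} (R : ι → ι → Prop) : Submodule K (Matrix ι ι K) where
  carrier := {x | ∀ i j, ¬ R i j → x i j = 0}
  add_mem' := by
    intro x y hx hy i j h
    simp [hx i j h, hy i j h]
  zero_mem' := fun i j _ => rfl
  smul_mem' := by
    intro c x hx i j h
    simp [hx i j h]

section

variable {K : Type*} [Field K]

lemma mem_suppMat {ι : Type*} {R : ι → ι → Prop} {x : Matrix ι ι K} :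
    x ∈ suppMat K R ↔ ∀ i j, ¬ R i j → x i j = 0 := Iff.rfl

lemma suppMat_mul_mem {ι : Type*} [Fintype ι] {R S T : ι → ι → Prop}
    (hR : ∀ i j k, R i j → S j k → T i k)
    {x y : Matrix ι ι K} (hx : x ∈ suppMat K R) (hy : y ∈ suppMat K S) :
    x * y ∈ suppMat K T := by
  intro i j h
  rw [Matrix.mul_apply]
  refine Finset.sum_eq_zero fun k _ => ?_
  by_cases h1 : R i k
  · by_cases h2 : S k j
    · exact absurd (hR _ _ _ h1 h2) h
    · rw [hy _ _ h2, mul_zero]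
  · rw [hx _ _ h1, zero_mul]

/-- Inverses of invertible matrices supported on a preorder are supported on it. -/
lemma exists_inv_mem_suppMat {ι : Type*} [Fintype ι] [DecidableEq ι] {R : ι → ι → Prop}
    (hrefl : ∀ i, R i i) (htrans : ∀ i j k, R i j → R j k → R i k) {u : Matrix ι ι K}
    (hu : u ∈ suppMat K R) (hunit : IsUnit u) : ∃ v ∈ suppMat K R, u * v = 1 ∧ v * u = 1 := by
  obtain ⟨w, hw⟩ := hunit.exists_left_inv
  -- Left multiplication by u is injective on this finite-dimensional algebra, hence surjective, so
  -- it reaches 1 without leaving the algebra.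
  let L : suppMat K R →ₗ[K] suppMat K R :=
    (LinearMap.mulLeft K u).restrict fun x hx => suppMat_mul_mem htrans hu hx
  have hL : ∀ x : suppMat K R, (L x : Matrix ι ι K) = u * x := fun x => rfl
  have hinj : Function.Injective L := by
    intro x y hxy
    have h := congrArg (fun z : suppMat K R => w * (z : Matrix ι ι K)) hxy
    simp only [hL, ← mul_assoc, hw, one_mul] at h
    exact Subtype.ext h
  have hone : (1 : Matrix ι ι K) ∈ suppMat K R := by
    intro i j hij
    exact Matrix.one_apply_ne fun h => hij (h ▸ hrefl i)
  obtain ⟨v, hv⟩ := (LinearMap.injective_iff_surjective.mp hinj) ⟨1, hone⟩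
  have huv : u * (v : Matrix ι ι K) = 1 := by rw [← hL, hv]
  exact ⟨v, v.2, huv, mul_eq_one_comm.mp huv⟩

lemma single_mem_suppMat {ι : Type*} [DecidableEq ι] {R : ι → ι → Prop} {i j : ι} (h : R i j) (c : K) :
    single i j c ∈ suppMat K R := by
  intro k l hkl
  refine Matrix.single_apply_of_ne _ _ _ _ _ ?_
  rintro ⟨rfl, rfl⟩
  exact hkl h

variable {ι : Type*} [Fintype ι] [DecidableEq ι]

lemma map_eq_zero_of_mem_suppMat {R : ι → ι → Prop} (g : Matrix ι ι K →ₗ[K] K)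
    (hg : ∀ i j, R i j → g (single i j 1) = 0) {x : Matrix ι ι K} (hx : x ∈ suppMat K R) :
    g x = 0 := by
  rw [matrix_eq_sum_single x, map_sum]
  refine Finset.sum_eq_zero fun i _ => ?_
  rw [map_sum]
  refine Finset.sum_eq_zero fun j _ => ?_
  by_cases h : R i j
  · rw [← mul_one (x i j), ← smul_eq_mul, ← smul_single, map_smul, hg i j h, smul_zero]
  · rw [hx i j h]; simp

lemma map_single_mul (f : Matrix ι ι K →ₗ[K] K) (i j : ι) (x : Matrix ι ι K) :
    f (single i j 1 * x) = ∑ l, x j l * f (single i l 1) := by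
  have h : single i j 1 * x = ∑ l, x j l • single i l (1 : K) := by
    ext k l
    simp only [Matrix.sum_apply, Matrix.smul_apply, smul_eq_mul]
    by_cases hk : i = k
    · subst hk
      rw [Matrix.single_mul_apply_same, one_mul, Finset.sum_eq_single l]
      · simp
      · intro b _ hb; simp [hb]
      · simp
    · rw [Matrix.single_mul_apply_of_ne _ _ _ _ _ (Ne.symm hk)]
      simp [hk]
  rw [h, map_sum]
  simp only [map_smul, smul_eq_mul]

lemma map_mul_single (f : Matrix ι ι K →ₗ[K] K) (i j : ι) (x : Matrix ι ι K) :
    f (x * single i j 1) = ∑ k, x k i * f (single k j 1) := by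
  have h : x * single i j 1 = ∑ k, x k i • single k j (1 : K) := by
    ext k l
    simp only [Matrix.sum_apply, Matrix.smul_apply, smul_eq_mul]
    by_cases hl : j = l
    · subst hl
      rw [Matrix.mul_single_apply_same, mul_one, Finset.sum_eq_single k]
      · simp
      · intro b _ hb; simp [hb]
      · simp
    · rw [Matrix.mul_single_apply_of_ne _ _ _ _ _ (Ne.symm hl)]
      simp [hl]
  rw [h, map_sum]
  simp only [map_smul, smul_eq_mul]

end

/-! ### One reduction step: the data and the embedding of the smaller algebra. -/

/-- Move the indices in `[s, s + e)` up by `h`. -/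
def shiftUp {n : ℕ} (s e h : ℕ) (i : Fin n) : Fin n :=
  if H : s ≤ (i : ℕ) ∧ (i : ℕ) < s + e ∧ (i : ℕ) + h < n then ⟨i + h, H.2.2⟩ else i

/-- Move the indices in `[s + h, s + e + h)` down by `h`. -/
def shiftDown {n : ℕ} (s e h : ℕ) (j : Fin n) : Fin n :=
  if s + h ≤ (j : ℕ) ∧ (j : ℕ) < s + e + h then ⟨j - h, by omega⟩ else j

lemma shiftUp_val {n s e h : ℕ} (hn : s + e + h ≤ n) (i : Fin n) :
    (shiftUp s e h i : ℕ) = if s ≤ (i : ℕ) ∧ (i : ℕ) < s + e then (i : ℕ) + h else i := by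
  unfold shiftUp
  split_ifs with h1 h2 h2
  · rfl
  · omega
  · omega
  · rfl

lemma shiftDown_val {n s e h : ℕ} (j : Fin n) :
    (shiftDown s e h j : ℕ) =
      if s + h ≤ (j : ℕ) ∧ (j : ℕ) < s + e + h then (j : ℕ) - h else j := by
  unfold shiftDown
  split_ifs <;> rfl

/-- The relation `R'` arises from `R` by one step of the meander reduction. -/
structure IsReduction {n : ℕ} (s e h a : ℕ) (R R' : Fin n → Fin n → Prop) : Prop where
  -- Here s is the first active index, a the smaller first part and b = e + h the larger one; e and
  -- h are the minimum and maximum of a and b - a. The corner has size a × (b - a), and e indices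
  -- are removed.
  le : e ≤ h
  hn : s + e + h ≤ n
  ha : a = e ∨ a = h
  supp : ∀ i j, R i j → s ≤ (i : ℕ) ∧ s ≤ (j : ℕ)
  row : ∀ i j : Fin n, s ≤ (i : ℕ) → (i : ℕ) < s + a →
    (R i j ↔ s ≤ (j : ℕ) ∧ (j : ℕ) < s + e + h)
  col : ∀ i j, R i j → (j : ℕ) < s + a → (i : ℕ) < s + a
  row' : ∀ i j, R i j → s + a ≤ (i : ℕ) → (i : ℕ) < s + e + h →
    s + a ≤ (j : ℕ) ∧ (j : ℕ) < s + e + h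
  -- These entries detect the corner columns before s + h and supply the unipotent matrices that
  -- clear them.
  mid : ∀ i j : Fin n, s + e ≤ (i : ℕ) → (i : ℕ) < s + h → s + h ≤ (j : ℕ) →
    (j : ℕ) < s + e + h → R i j
  trans : ∀ i j k, R i j → R j k → R i k
  -- When a = e the excluded positions cut what remains of the larger block into parts h - e and e,
  -- in this order.
  red : ∀ i j : Fin n, R' i j ↔ s + e ≤ (i : ℕ) ∧ s + e ≤ (j : ℕ) ∧ R i j ∧
    ¬ (a = e ∧ (i : ℕ) < s + h ∧ s + h ≤ (j : ℕ) ∧ (j : ℕ) < s + e + h)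

namespace IsReduction

variable {K : Type*} [Field K] {n s e h a : ℕ} {R R' : Fin n → Fin n → Prop}

/-- The positions of the abelian ideal along which one reduces. -/
def cornerRel (n s a c : ℕ) (i j : Fin n) : Prop :=
  s ≤ (i : ℕ) ∧ (i : ℕ) < s + a ∧ s + a ≤ (j : ℕ) ∧ (j : ℕ) < c

/-- The embedding of the reduced algebra as a stabilizer. -/
def embed (K : Type*) [Field K] (n s e h a : ℕ) :
    Matrix (Fin n) (Fin n) K →ₗ[K] Matrix (Fin n) (Fin n) K where
  -- The block on indices below s + a repeats the entries of x at the shifted indices, so that the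
  -- two copies cancel in commutators with the corner; the corner itself is left empty.
  toFun x := Matrix.of fun i j =>
    if (i : ℕ) < s + a ∧ (j : ℕ) < s + a then x (shiftUp s e h i) (shiftUp s e h j)
    else if s + a ≤ (i : ℕ) ∧ s + a ≤ (j : ℕ) then x i j else 0
  map_add' x y := by
    ext i j; simp only [Matrix.of_apply, Matrix.add_apply]; split_ifs <;> simp
  map_smul' c x := by
    ext i j; simp only [Matrix.of_apply, Matrix.smul_apply]; split_ifs <;> simp

/-- A linear map which restricts to an inverse of `embed`. -/
def retract (K : Type*) [Field K] (n s e h a : ℕ) :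
    Matrix (Fin n) (Fin n) K →ₗ[K] Matrix (Fin n) (Fin n) K where
  toFun x := Matrix.of fun i j =>
    -- These entries fall in the corner erased by `embed` and are read from the shifted copy. The
    -- case occurs only for a = h.
    if s + e ≤ (i : ℕ) ∧ (i : ℕ) < s + a ∧ s + h ≤ (j : ℕ) ∧ (j : ℕ) < s + e + h then
      x i (shiftDown s e h j)
    else if s + e ≤ (i : ℕ) ∧ s + e ≤ (j : ℕ) then x i j else 0
  map_add' x y := by
    ext i j; simp only [Matrix.of_apply, Matrix.add_apply]; split_ifs <;> simp
  map_smul' c x := by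
    ext i j; simp only [Matrix.of_apply, Matrix.smul_apply]; split_ifs <;> simp

lemma embed_apply (x : Matrix (Fin n) (Fin n) K) (i j : Fin n) : embed K n s e h a x i j =
    if (i : ℕ) < s + a ∧ (j : ℕ) < s + a then x (shiftUp s e h i) (shiftUp s e h j)
    else if s + a ≤ (i : ℕ) ∧ s + a ≤ (j : ℕ) then x i j else 0 := rfl

lemma retract_apply (x : Matrix (Fin n) (Fin n) K) (i j : Fin n) : retract K n s e h a x i j =
    if s + e ≤ (i : ℕ) ∧ (i : ℕ) < s + a ∧ s + h ≤ (j : ℕ) ∧ (j : ℕ) < s + e + h then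
      x i (shiftDown s e h j)
    else if s + e ≤ (i : ℕ) ∧ s + e ≤ (j : ℕ) then x i j else 0 := rfl

/-- The functional is the standard one on the corner. -/
def StdOn (s e h a : ℕ) (f : Matrix (Fin n) (Fin n) K →ₗ[K] K) : Prop :=
  ∀ i j : Fin n, s ≤ (i : ℕ) → (i : ℕ) < s + a → s + a ≤ (j : ℕ) → (j : ℕ) < s + e + h →
    f (single i j 1) = if (j : ℕ) = i + h then 1 else 0

variable (H : IsReduction s e h a R R')

include H

lemma trans' : ∀ i j k, R' i j → R' j k → R' i k := by
  intro i j k hij hjk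
  rw [H.red] at hij hjk ⊢
  have ht := H.trans _ _ _ hij.2.2.1 hjk.2.2.1
  refine ⟨hij.1, hjk.2.1, ht, ?_⟩
  rintro ⟨h1, h2, h3, h4⟩
  have h5 := H.row' i j hij.2.2.1 (by omega) (by have := H.le; omega)
  by_cases h6 : (j : ℕ) < s + h
  · exact hjk.2.2.2 ⟨h1, h6, h3, h4⟩
  · exact hij.2.2.2 ⟨h1, h2, by omega, h5.2⟩

lemma embed_mem {x : Matrix (Fin n) (Fin n) K} (hx : x ∈ suppMat K R') :
    embed K n s e h a x ∈ suppMat K R := by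
  intro i j hij
  have hle := H.le
  have ha := H.ha
  rw [embed_apply]
  split_ifs with h1 h2
  · refine hx _ _ fun h3 => hij ?_
    rw [H.red, shiftUp_val H.hn, shiftUp_val H.hn] at h3
    obtain ⟨h4, h5, -⟩ := h3
    rw [H.row i j (by split_ifs at h4 <;> omega) h1.1]
    split_ifs at h5 <;> omega
  · exact hx _ _ fun h3 => hij ((H.red _ _).mp h3).2.2.1
  · rfl

lemma retract_embed {x : Matrix (Fin n) (Fin n) K} (hx : x ∈ suppMat K R') :
    retract K n s e h a (embed K n s e h a x) = x := by
  have hle := H.le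
  have ha := H.ha
  have hn := H.hn
  ext i j
  rw [retract_apply]
  split_ifs with h1 h2
  · have hj := shiftDown_val (s := s) (e := e) (h := h) j
    rw [if_pos (by omega)] at hj
    rw [embed_apply, if_pos (by omega)]
    congr 1
    · apply Fin.ext; rw [shiftUp_val hn, if_neg (by omega)]
    · apply Fin.ext; rw [shiftUp_val hn, if_pos (by omega)]; omega
  · rw [embed_apply]
    split_ifs with h3 h4
    · congr 1
      · apply Fin.ext; rw [shiftUp_val hn, if_neg (by omega)]
      · apply Fin.ext; rw [shiftUp_val hn, if_neg (by omega)]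
    · rfl
    · symm
      refine hx _ _ fun h5 => ?_
      rw [H.red] at h5
      by_cases h6 : (j : ℕ) < s + a
      · have := H.col _ _ h5.2.2.1 h6
        omega
      · have := (H.row i j (by omega) (by omega)).mp h5.2.2.1
        omega
  · symm
    refine hx _ _ fun h5 => ?_
    rw [H.red] at h5
    omega

lemma embed_mul {x y : Matrix (Fin n) (Fin n) K} (hx : x ∈ suppMat K R')
    (hy : y ∈ suppMat K R') :
    embed K n s e h a (x * y) = embed K n s e h a x * embed K n s e h a y := by
  have hle := H.le
  have ha := H.ha
  have hn := H.hn
  ext i j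
  rw [Matrix.mul_apply, embed_apply]
  split_ifs with h1 h2
  · rw [Matrix.mul_apply]
    symm
    refine Finset.sum_bij_ne_zero (fun k _ _ => shiftUp s e h k) (fun _ _ _ => Finset.mem_univ _)
      ?_ ?_ ?_
    · intro k _ hk l _ hl hkl
      have hk1 : (k : ℕ) < s + a ∧ R' (shiftUp s e h i) (shiftUp s e h k) := by
        by_contra hc
        apply hk
        by_cases hka : (k : ℕ) < s + a
        · rw [embed_apply, if_pos ⟨h1.1, hka⟩, hx _ _ fun h => hc ⟨hka, h⟩, zero_mul]
        · rw [embed_apply, if_neg (by omega), if_neg (by omega), zero_mul]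
      have hl1 : (l : ℕ) < s + a ∧ R' (shiftUp s e h i) (shiftUp s e h l) := by
        by_contra hc
        apply hl
        by_cases hka : (l : ℕ) < s + a
        · rw [embed_apply, if_pos ⟨h1.1, hka⟩, hx _ _ fun h => hc ⟨hka, h⟩, zero_mul]
        · rw [embed_apply, if_neg (by omega), if_neg (by omega), zero_mul]
      rw [H.red] at hk1 hl1
      have e1 := congrArg Fin.val hkl
      have e2 := hk1.2.2.1
      have e3 := hl1.2.2.1
      rw [shiftUp_val hn] at e1 e2 e3
      rw [shiftUp_val hn] at e1
      apply Fin.ext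
      split_ifs at e1 e2 e3 <;> omega
    · intro k _ hk
      have hxk : R' (shiftUp s e h i) k := by
        by_contra hc
        rw [hx _ _ hc, zero_mul] at hk; exact hk rfl
      have hyk : R' k (shiftUp s e h j) := by
        by_contra hc
        rw [hy _ _ hc, mul_zero] at hk; exact hk rfl
      rw [H.red] at hxk hyk
      obtain ⟨a1, a2, a3, a4⟩ := hxk
      obtain ⟨b1, b2, b3, b4⟩ := hyk
      have hi := shiftUp_val hn i
      have hj := shiftUp_val hn j
      -- A contributing intermediate index must lie in the image of `shiftUp`. For a = e this is
      -- where the positions excluded by `red` are needed: they rule out the middle indices.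
      have hk' : (k : ℕ) < s + e + h ∧ (a = e → s + h ≤ (k : ℕ)) := by
        rcases ha with ha | ha
        · rw [if_pos (by split_ifs at hi <;> omega)] at hi
          have hjs : s ≤ (j : ℕ) := by split_ifs at hj <;> omega
          rw [if_pos (by split_ifs at hj <;> omega)] at hj
          have r1 := H.row' _ _ a3 (by omega) (by omega)
          exact ⟨r1.2, fun _ => by by_contra hc; exact b4 ⟨ha, by omega, by omega, by omega⟩⟩
        · by_cases hia : (shiftUp s e h i : ℕ) < s + a
          · have := (H.row _ _ (by omega) hia).mp a3
            refine ⟨this.2, fun h' => ?_⟩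
            exfalso
            split_ifs at hi <;> omega
          · have := H.row' _ _ a3 (by omega) (by split_ifs at hi <;> omega)
            exact ⟨this.2, fun h' => by omega⟩
      by_cases hkh : (k : ℕ) < s + h
      · have hae : a = h := by rcases ha with ha | ha <;> [have := hk'.2 ha; skip] <;> omega
        have hs : shiftUp s e h k = k := by
          apply Fin.ext; rw [shiftUp_val hn, if_neg (by omega)]
        refine ⟨k, Finset.mem_univ _, ?_, hs⟩
        rw [embed_apply, embed_apply, if_pos (by omega), if_pos (by omega), hs]
        exact hk
      · have hd := shiftDown_val (s := s) (e := e) (h := h) k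
        rw [if_pos (by omega)] at hd
        have hs : shiftUp s e h (shiftDown s e h k) = k := by
          apply Fin.ext; rw [shiftUp_val hn, if_pos (by omega)]; omega
        refine ⟨shiftDown s e h k, Finset.mem_univ _, ?_, hs⟩
        rw [embed_apply, embed_apply, if_pos (by omega), if_pos (by omega), hs]
        exact hk
    · intro k _ hk
      have hka : (k : ℕ) < s + a := by
        by_contra hc
        apply hk
        rw [embed_apply, if_neg (by omega), if_neg (by omega), zero_mul]
      rw [embed_apply, embed_apply, if_pos (by omega), if_pos (by omega)]
  · rw [Matrix.mul_apply]
    refine Finset.sum_congr rfl fun k _ => ?_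
    by_cases hk : (k : ℕ) < s + a
    · have hxk : x i k = 0 := hx _ _ fun hc => by
        have := H.col _ _ ((H.red _ _).mp hc).2.2.1 hk
        omega
      rw [hxk, zero_mul, embed_apply, if_neg (by omega), if_neg (by omega), zero_mul]
    · rw [embed_apply, embed_apply, if_neg (by omega), if_pos (by omega), if_neg (by omega),
        if_pos (by omega)]
  · symm
    refine Finset.sum_eq_zero fun k _ => ?_
    by_cases hk : (k : ℕ) < s + a
    · by_cases hi : (i : ℕ) < s + a
      · rw [embed_apply (i := k), if_neg (by omega), if_neg (by omega), mul_zero]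
      · rw [embed_apply (i := i), if_neg (by omega), if_neg (by omega), zero_mul]
    · by_cases hi : (i : ℕ) < s + a
      · rw [embed_apply (i := i), if_neg (by omega), if_neg (by omega), zero_mul]
      · rw [embed_apply (i := k), if_neg (by omega), if_neg (by omega), mul_zero]

end IsReduction


/-! ### The radical of a form that is standard on the corner. -/

namespace IsReduction

variable {K : Type*} [Field K] {n s e h a : ℕ} {R R' : Fin n → Fin n → Prop}
  (H : IsReduction s e h a R R')

lemma corner_mul_corner {v w : Matrix (Fin n) (Fin n) K}
    (hv : v ∈ suppMat K (cornerRel n s a (s + e + h)))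
    (hw : w ∈ suppMat K (cornerRel n s a (s + e + h))) : v * w = 0 := by
  ext i j
  rw [Matrix.mul_apply]
  refine Finset.sum_eq_zero fun k _ => ?_
  by_cases hk : (k : ℕ) < s + a
  · rw [hv i k fun hc => by have := hc.2.2.1; omega, zero_mul]
  · rw [hw k j fun hc => by have := hc.2.1; omega, mul_zero]

include H

lemma corner_le : suppMat K (cornerRel n s a (s + e + h)) ≤ suppMat K R := by
  intro x hx i j hij
  refine hx i j fun hc => hij ?_
  exact (H.row i j hc.1 hc.2.1).mpr ⟨by have := hc.2.2.1; omega, hc.2.2.2⟩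

/-- With `map_mul_single_of_std`, this turns orthogonality to the corner into the equations x j (i +
h) = x (j - h) i, a side whose shifted index is out of range being 0. -/
lemma map_single_mul_of_std {f : Matrix (Fin n) (Fin n) K →ₗ[K] K} (hf : StdOn s e h a f)
    {x : Matrix (Fin n) (Fin n) K} (hx : x ∈ suppMat K R) {i j : Fin n}
    (hij : cornerRel n s a (s + e + h) i j) :
    f (single i j 1 * x) = if (i : ℕ) < s + e then x j (shiftUp s e h i) else 0 := by
  obtain ⟨h1, h2, h3, h4⟩ := hij
  have hle := H.le
  have hn := H.hn
  have ha := H.ha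
  have key : ∀ l : Fin n, x j l * f (single i l 1) = if (l : ℕ) = i + h then x j l else 0 := by
    intro l
    by_cases hl : R j l
    · have := H.row' _ _ hl h3 h4
      rw [hf i l h1 h2 this.1 this.2]
      simp
    · simp [hx _ _ hl]
  rw [map_single_mul]
  simp only [key]
  have hv := shiftUp_val hn i
  split_ifs with h5
  · rw [if_pos ⟨h1, h5⟩] at hv
    rw [Finset.sum_eq_single (shiftUp s e h i), if_pos hv]
    · intro l _ hl
      exact if_neg fun hc => hl (Fin.ext (by omega))
    · simp
  · refine Finset.sum_eq_zero fun l _ => ?_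
    split_ifs with h6
    · refine hx _ _ fun hc => ?_
      have := H.row' _ _ hc h3 h4
      omega
    · rfl

lemma map_mul_single_of_std {f : Matrix (Fin n) (Fin n) K →ₗ[K] K} (hf : StdOn s e h a f)
    {x : Matrix (Fin n) (Fin n) K} (hx : x ∈ suppMat K R) {i j : Fin n}
    (hij : cornerRel n s a (s + e + h) i j) :
    f (x * single i j 1) = if s + h ≤ (j : ℕ) then x (shiftDown s e h j) i else 0 := by
  obtain ⟨h1, h2, h3, h4⟩ := hij
  have hle := H.le
  have hn := H.hn
  have ha := H.ha
  have key : ∀ k : Fin n, x k i * f (single k j 1) =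
      if s ≤ (k : ℕ) ∧ (j : ℕ) = k + h then x k i else 0 := by
    intro k
    by_cases hk : R k i
    · have h5 := H.col _ _ hk h2
      have h6 := (H.supp _ _ hk).1
      rw [hf k j h6 h5 h3 h4]
      simp [h6]
    · simp [hx _ _ hk]
  rw [map_mul_single]
  simp only [key]
  have hv := shiftDown_val (s := s) (e := e) (h := h) j
  split_ifs with h5
  · rw [if_pos ⟨h5, h4⟩] at hv
    rw [Finset.sum_eq_single (shiftDown s e h j), if_pos (by omega)]
    · intro k _ hk
      exact if_neg fun hc => hk (Fin.ext (by omega))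
    · simp
  · refine Finset.sum_eq_zero fun k _ => if_neg (by omega)

/-- The orthogonality relations between the corner and the embedded reduced algebra. -/
lemma map_commutator_corner {f : Matrix (Fin n) (Fin n) K →ₗ[K] K} (hf : StdOn s e h a f)
    {v y : Matrix (Fin n) (Fin n) K} (hv : v ∈ suppMat K (cornerRel n s a (s + e + h)))
    (hy : y ∈ suppMat K R') :
    f (v * embed K n s e h a y - embed K n s e h a y * v) = 0 := by
  have hle := H.le
  have hn := H.hn
  have ha := H.ha
  let g : Matrix (Fin n) (Fin n) K →ₗ[K] K := (commForm f).flip (embed K n s e h a y)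
  refine map_eq_zero_of_mem_suppMat g ?_ hv
  intro i j hij
  change f (single i j 1 * embed K n s e h a y - embed K n s e h a y * single i j 1) = 0
  rw [map_sub, H.map_single_mul_of_std hf (H.embed_mem hy) hij,
    H.map_mul_single_of_std hf (H.embed_mem hy) hij]
  obtain ⟨h1, h2, h3, h4⟩ := hij
  have hu := shiftUp_val hn i
  have hd := shiftDown_val (s := s) (e := e) (h := h) j
  split_ifs with h5 h6 h6
  · rw [if_pos (by omega)] at hu hd
    rw [embed_apply, embed_apply, if_neg (by omega), if_pos (by omega), if_pos (by omega)]
    have : shiftUp s e h (shiftDown s e h j) = j := by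
      apply Fin.ext; rw [shiftUp_val hn, if_pos (by omega)]; omega
    rw [this, sub_self]
  · rw [if_pos (by omega)] at hu
    rw [embed_apply, if_neg (by omega), if_pos (by omega), sub_zero]
    refine hy _ _ fun hc => ?_
    exact ((H.red _ _).mp hc).2.2.2 (by omega)
  · rw [if_pos (by omega)] at hd
    rw [embed_apply, if_pos (by omega), zero_sub, neg_eq_zero]
    refine hy _ _ fun hc => ?_
    have h7 := H.col _ _ ((H.red _ _).mp hc).2.2.1
    rw [shiftUp_val hn, shiftUp_val hn, if_neg (by omega), if_pos (by omega)] at h7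
    omega
  · simp

/-- Pairing v with one matrix unit isolates one entry v i j: the unit at (j - h, i) when j ≥ s + h,
and otherwise the unit at (j, i + h), which is available by `mid`. -/
lemma corner_nondegenerate {f : Matrix (Fin n) (Fin n) K →ₗ[K] K} (hf : StdOn s e h a f)
    {v : Matrix (Fin n) (Fin n) K} (hv : v ∈ suppMat K (cornerRel n s a (s + e + h)))
    (hv' : ∀ y ∈ suppMat K R, f (v * y - y * v) = 0) : v = 0 := by
  have hle := H.le
  have hn := H.hn
  have ha := H.ha
  have hS : ∀ k l : Fin n, R k l →
      ∑ i, v i k * f (single i l 1) = ∑ j, v l j * f (single k j 1) := by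
    intro k l hkl
    have := hv' _ (single_mem_suppMat hkl 1)
    rw [map_sub, map_mul_single, map_single_mul] at this
    exact sub_eq_zero.mp this
  ext i j
  by_cases hij : cornerRel n s a (s + e + h) i j
  swap
  · exact hv i j hij
  obtain ⟨h1, h2, h3, h4⟩ := hij
  by_cases hj : s + h ≤ (j : ℕ)
  · have hd := shiftDown_val (s := s) (e := e) (h := h) j
    rw [if_pos (by omega)] at hd
    have := hS (shiftDown s e h j) i ((H.row _ _ (by omega) (by omega)).mpr (by omega))
    rw [Finset.sum_eq_zero, Finset.sum_eq_single j] at this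
    · rw [hf _ _ (by omega) (by omega) h3 h4, if_pos (by omega), mul_one] at this
      exact this.symm
    · intro l _ hl
      by_cases hc : cornerRel n s a (s + e + h) i l
      · rw [hf _ _ (by omega) (by omega) hc.2.2.1 hc.2.2.2,
          if_neg fun hc' => hl (Fin.ext (by omega)), mul_zero]
      · rw [hv _ _ hc, zero_mul]
    · simp
    · intro k _
      rw [hv _ _ fun hc => by have := hc.2.2.1; omega, zero_mul]
  · have hu := shiftUp_val hn i
    rw [if_pos (by omega)] at hu
    have := hS j (shiftUp s e h i) (H.mid _ _ (by omega) (by omega) (by omega) (by omega))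
    rw [Finset.sum_eq_single i] at this
    · rw [hf _ _ (by omega) (by omega) (by omega) (by omega), if_pos (by omega), mul_one] at this
      rw [this]
      refine Finset.sum_eq_zero fun l _ => ?_
      rw [hv _ _ fun hc => by have := hc.2.1; omega, zero_mul]
    · intro l _ hl
      by_cases hc : cornerRel n s a (s + e + h) l j
      · rw [hf _ _ hc.1 hc.2.1 (by omega) (by omega),
          if_neg fun hc' => hl (Fin.ext (by omega)), mul_zero]
      · rw [hv _ _ hc, zero_mul]
    · simp

/-- The equations expressing orthogonality to the corner say that x repeats its shifted entries
exactly as `embed` does, and vanishes at the positions excluded by `red`. This gives the inclusion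
V^⊥ ⊆ V ⊕ s. -/
lemma retract_mem_and_sub_mem {f : Matrix (Fin n) (Fin n) K →ₗ[K] K} (hf : StdOn s e h a f)
    {x : Matrix (Fin n) (Fin n) K} (hx : x ∈ suppMat K R)
    (hp : ∀ v ∈ suppMat K (cornerRel n s a (s + e + h)), f (v * x - x * v) = 0) :
    retract K n s e h a x ∈ suppMat K R' ∧
      x - embed K n s e h a (retract K n s e h a x) ∈
        suppMat K (cornerRel n s a (s + e + h)) := by
  have hle := H.le
  have hn := H.hn
  have ha := H.ha
  have key : ∀ i j : Fin n, cornerRel n s a (s + e + h) i j →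
      (if (i : ℕ) < s + e then x j (shiftUp s e h i) else 0) =
        if s + h ≤ (j : ℕ) then x (shiftDown s e h j) i else 0 := by
    intro i j hij
    have := hp _ (single_mem_suppMat hij 1)
    rw [map_sub, H.map_single_mul_of_std hf hx hij, H.map_mul_single_of_std hf hx hij] at this
    exact sub_eq_zero.mp this
  constructor
  · intro i j hij
    rw [retract_apply]
    split_ifs with h1 h2
    · exfalso
      apply hij
      rw [H.red, H.row _ _ (by omega) (by omega)]
      omega
    · by_cases hR : R i j
      · by_cases hc : a = e ∧ (i : ℕ) < s + h ∧ s + h ≤ (j : ℕ) ∧ (j : ℕ) < s + e + h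
        · have hd := shiftDown_val (s := s) (e := e) (h := h) j
          rw [if_pos (by omega)] at hd
          have hs : shiftUp s e h (shiftDown s e h j) = j := by
            apply Fin.ext; rw [shiftUp_val hn, if_pos (by omega)]; omega
          have := key (shiftDown s e h j) i (by unfold cornerRel; omega)
          rw [if_pos (by omega), if_neg (by omega), hs] at this
          exact this
        · exact absurd ((H.red _ _).mpr ⟨h2.1, h2.2, hR, hc⟩) hij
      · exact hx _ _ hR
    · rfl
  · intro i j hij
    rw [Matrix.sub_apply, sub_eq_zero, embed_apply]
    have hui := shiftUp_val hn i
    have huj := shiftUp_val hn j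
    split_ifs with h1 h2
    · rw [retract_apply]
      by_cases hs : s ≤ (i : ℕ) ∧ s ≤ (j : ℕ)
      swap
      · rw [hx _ _ fun hc => hs (H.supp _ _ hc)]
        split_ifs at hui huj <;> rw [if_neg (by omega), if_neg (by omega)]
      by_cases hi : (i : ℕ) < s + e
      · rw [if_pos (by omega)] at hui
        have hdu : shiftDown s e h (shiftUp s e h i) = i := by
          apply Fin.ext; rw [shiftDown_val, if_pos (by omega)]; omega
        have hk := key j (shiftUp s e h i) (by unfold cornerRel; omega)
        rw [if_pos (by omega : s + h ≤ (shiftUp s e h i : ℕ)), hdu] at hk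
        by_cases hj : (j : ℕ) < s + e
        · rw [if_pos (by omega)] at huj hk
          rw [if_neg (by omega), if_pos (by omega), hk]
        · rw [if_neg (by omega)] at huj hk
          rw [if_neg (by omega), if_pos (by omega), ← hk]
          symm
          refine hx _ _ fun hc => ?_
          have := H.col _ _ hc (by omega)
          omega
      · rw [if_neg (by omega)] at hui
        have hii : shiftUp s e h i = i := Fin.ext hui
        by_cases hj : (j : ℕ) < s + e
        · rw [if_pos (by omega)] at huj
          have hdu : shiftDown s e h (shiftUp s e h j) = j := by
            apply Fin.ext; rw [shiftDown_val, if_pos (by omega)]; omega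
          rw [if_pos (by omega), hdu, hii]
        · rw [if_neg (by omega)] at huj
          have hjj : shiftUp s e h j = j := Fin.ext huj
          rw [if_neg (by omega), if_pos (by omega), hii, hjj]
    · rw [retract_apply, if_neg (by omega), if_pos (by omega)]
    · refine hx _ _ fun hc => ?_
      have hs := H.supp _ _ hc
      by_cases hi : (i : ℕ) < s + a
      · have := (H.row _ _ hs.1 hi).mp hc
        exact hij ⟨hs.1, hi, by omega, this.2⟩
      · have := H.col _ _ hc (by omega)
        omega

/-- For a functional which is standard on the corner, the radical has the dimension of the radical
of the induced functional on the reduced algebra. -/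
theorem finrank_radical_eq {f : Matrix (Fin n) (Fin n) K →ₗ[K] K} (hf : StdOn s e h a f) :
    finrank K (radical (suppMat K R) f) =
      finrank K (radical (suppMat K R') (f ∘ₗ embed K n s e h a)) := by
  rw [← finrank_radical_map _ (fun x hx y hy => H.embed_mul hx hy)]
  · refine finrank_radical_reduction (V := suppMat K (cornerRel n s a (s + e + h))) H.corner_le
      ?_ ?_ ?_ ?_ ?_ ?_
    · rintro _ ⟨x, hx, rfl⟩
      exact H.embed_mem hx
    · intro v hv w hw
      rw [corner_mul_corner hv hw, corner_mul_corner hw hv]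
      simp
    · rintro v hv _ ⟨y, hy, rfl⟩
      exact H.map_commutator_corner hf hv hy
    · rw [Submodule.disjoint_def]
      rintro _ hv ⟨y, hy, rfl⟩
      ext i j
      by_cases hc : cornerRel n s a (s + e + h) i j
      · rw [embed_apply, if_neg (by have := hc.2.2.1; omega), if_neg (by have := hc.2.1; omega)]
        rfl
      · exact hv i j hc
    · exact fun v hv hv' => H.corner_nondegenerate hf hv hv'
    · intro x hx hp
      obtain ⟨h1, h2⟩ := H.retract_mem_and_sub_mem hf hx hp
      exact Submodule.mem_sup.mpr ⟨_, h2, _, ⟨_, h1, rfl⟩, sub_add_cancel _ _⟩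
  · intro x hx h0
    rw [← H.retract_embed hx, h0, map_zero]

/-- A functional, standard on the corner, extending a given one on the reduced algebra. -/
theorem exists_std_extension (f' : Matrix (Fin n) (Fin n) K →ₗ[K] K) :
    ∃ f : Matrix (Fin n) (Fin n) K →ₗ[K] K, StdOn s e h a f ∧
      ∀ x ∈ suppMat K R', f (embed K n s e h a x) = f' x := by
  have hle := H.le
  have hn := H.hn
  have ha := H.ha
  -- g gives the standard pattern on the corner and vanishes on the image of `embed`, whereas f' ∘
  -- `retract` vanishes on the corner and recovers f' on that image.
  let g : Matrix (Fin n) (Fin n) K →ₗ[K] K :=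
    ∑ i : Fin n, ∑ j : Fin n,
      if s ≤ (i : ℕ) ∧ (i : ℕ) < s + e ∧ (j : ℕ) = i + h then
        Matrix.entryLinearMap K K i j else 0
  have hg : ∀ x, g x = ∑ i : Fin n, ∑ j : Fin n,
      if s ≤ (i : ℕ) ∧ (i : ℕ) < s + e ∧ (j : ℕ) = i + h then x i j else 0 := by
    intro x
    simp only [g, LinearMap.sum_apply]
    refine Finset.sum_congr rfl fun i _ => Finset.sum_congr rfl fun j _ => ?_
    split_ifs <;> rfl
  refine ⟨g + f' ∘ₗ retract K n s e h a, ?_, ?_⟩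
  · intro i j h1 h2 h3 h4
    have h5 : retract K n s e h a (single i j (1 : K)) = 0 := by
      ext k l
      rw [retract_apply]
      split_ifs with h6 h7
      · have hd := shiftDown_val (s := s) (e := e) (h := h) l
        rw [if_pos (by omega)] at hd
        rw [single_apply_of_ne]
        · rfl
        · rintro ⟨rfl, rfl⟩
          omega
      · rw [single_apply_of_ne]
        · rfl
        · rintro ⟨rfl, rfl⟩
          omega
      · rfl
    rw [LinearMap.add_apply, LinearMap.comp_apply, h5, map_zero, add_zero, hg,
      Finset.sum_eq_single i, Finset.sum_eq_single j]
    · rw [single_apply_same]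
      exact if_congr (by omega) rfl rfl
    · intro l _ hl
      rw [single_apply_of_ne _ _ _ _ _ (by simp [hl.symm])]
      simp
    · simp
    · intro k _ hk
      refine Finset.sum_eq_zero fun l _ => ?_
      rw [single_apply_of_ne _ _ _ _ _ (by simp [hk.symm])]
      simp
    · simp
  · intro x hx
    rw [LinearMap.add_apply, LinearMap.comp_apply, H.retract_embed hx, hg,
      Finset.sum_eq_zero, zero_add]
    intro i _
    refine Finset.sum_eq_zero fun j _ => ?_
    split_ifs with h1
    · rw [embed_apply, if_neg (by omega), if_neg (by omega)]
    · rfl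

theorem hasIndex_upper {k : ℕ} (hk : HasIndex (suppMat K R') k) :
    ∃ f : Matrix (Fin n) (Fin n) K →ₗ[K] K, finrank K (radical (suppMat K R) f) ≤ k := by
  obtain ⟨f', hf'⟩ := hk.1
  obtain ⟨f, hf, hff'⟩ := H.exists_std_extension f'
  refine ⟨f, ?_⟩
  have hr : radical (suppMat K R') (f ∘ₗ embed K n s e h a) = radical (suppMat K R') f' :=
    radical_congr (fun x hx y hy => suppMat_mul_mem H.trans' hx hy) hff'
  rw [H.finrank_radical_eq hf, hr]
  exact hf'

end IsReduction


/-! ### Bringing an arbitrary form into standard shape. -/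

namespace IsReduction

variable {K : Type*} [Field K] {n s e h a : ℕ} {R R' : Fin n → Fin n → Prop}
  (H : IsReduction s e h a R R')

include H

/-- The relation R lives on indices from s on, so its algebra need not contain 1. Conjugation uses
the larger algebra with the diagonal adjoined, in which the matrices supported on R form an ideal.
-/
lemma finrank_radical_conj_eq {u v : Matrix (Fin n) (Fin n) K}
    (hu : u ∈ suppMat K fun i j => R i j ∨ i = j) (hv : v ∈ suppMat K fun i j => R i j ∨ i = j)
    (huv : u * v = 1) (hvu : v * u = 1) (f : Matrix (Fin n) (Fin n) K →ₗ[K] K) :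
    finrank K (radical (suppMat K R)
      (f ∘ₗ LinearMap.mulLeft K v ∘ₗ LinearMap.mulRight K u)) =
      finrank K (radical (suppMat K R) f) := by
  have h1 : ∀ i j k, R i j → (R j k ∨ j = k) → R i k := by
    rintro i j k h (h' | rfl)
    · exact H.trans _ _ _ h h'
    · exact h
  have h2 : ∀ i j k, (R i j ∨ i = j) → R j k → R i k := by
    rintro i j k (h' | rfl) h
    · exact H.trans _ _ _ h' h
    · exact h
  exact finrank_radical_conj huv hvu
    (fun x hx => suppMat_mul_mem (R := R) h1 (suppMat_mul_mem (S := R) (T := R) h2 hv hx) hu)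
    (fun x hx => suppMat_mul_mem (R := R) h1 (suppMat_mul_mem (S := R) (T := R) h2 hu hx) hv) f

/-- After a small perturbation and a conjugation, a functional is standard on the last columns of
the corner. -/
lemma exists_std_last [Infinite K] (f : Matrix (Fin n) (Fin n) K →ₗ[K] K) :
    ∃ f₁ : Matrix (Fin n) (Fin n) K →ₗ[K] K,
      finrank K (radical (suppMat K R) f₁) ≤ finrank K (radical (suppMat K R) f) ∧
      ∀ i j : Fin n, s ≤ (i : ℕ) → (i : ℕ) < s + a → s + h ≤ (j : ℕ) → (j : ℕ) < s + e + h →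
        f₁ (single i j 1) = if (j : ℕ) = i + h then 1 else 0 := by
  have hle := H.le
  have hn := H.hn
  have ha := H.ha
  -- On the last e columns of the corner, t • f + f₀ has the values of 1 + t • X, with X recording
  -- the values of f. For generic t this matrix is invertible and the radical is no larger than that
  -- of f.
  obtain ⟨f₀, hf₀, -⟩ := H.exists_std_extension (0 : Matrix (Fin n) (Fin n) K →ₗ[K] K)
  let X : Matrix (Fin n) (Fin n) K := Matrix.of fun i k =>
    if s ≤ (i : ℕ) ∧ (i : ℕ) < s + e ∧ s ≤ (k : ℕ) ∧ (k : ℕ) < s + a then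
      f (single k (shiftUp s e h i) 1) else 0
  have hX : ∀ i k, X i k =
    if s ≤ (i : ℕ) ∧ (i : ℕ) < s + e ∧ s ≤ (k : ℕ) ∧ (k : ℕ) < s + a then
      f (single k (shiftUp s e h i) 1) else 0 := fun _ _ => rfl
  obtain ⟨t, ht1, ht2⟩ := ((eventually_finrank_radical_le (suppMat K R) f f₀).and
    (eventually_isUnit_one_add_smul X)).exists
  set u : Matrix (Fin n) (Fin n) K := 1 + t • X with hu
  have humem : u ∈ suppMat K fun i j => R i j ∨ i = j := by
    intro i j hij
    rw [not_or] at hij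
    rw [hu, Matrix.add_apply, Matrix.one_apply_ne hij.2, Matrix.smul_apply, hX, if_neg, smul_zero,
      add_zero]
    intro hc
    exact hij.1 ((H.row _ _ hc.1 (by omega)).mpr (by omega))
  obtain ⟨v, hvmem, huv, hvu⟩ := exists_inv_mem_suppMat (R := fun i j => R i j ∨ i = j)
    (fun i => Or.inr rfl) (by
    rintro i j k (h1 | rfl) (h2 | rfl)
    · exact Or.inl (H.trans _ _ _ h1 h2)
    · exact Or.inl h1
    · exact Or.inl h2
    · exact Or.inr rfl) humem ht2
  refine ⟨_, (H.finrank_radical_conj_eq humem hvmem huv hvu _).trans_le ht1, ?_⟩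
  intro i j h1 h2 h3 h4
  have e1 : (single i j 1 : Matrix (Fin n) (Fin n) K) * u = single i j 1 := by
    rw [hu, mul_add, mul_one, add_eq_left, mul_smul_comm]
    ext k l
    rw [Matrix.smul_apply]
    by_cases hk : k = i
    · subst hk
      rw [Matrix.single_mul_apply_same, hX, if_neg (by omega)]
      simp
    · rw [Matrix.single_mul_apply_of_ne _ _ _ _ _ hk]
      simp
  have hd := shiftDown_val (s := s) (e := e) (h := h) j
  rw [if_pos (by omega)] at hd
  have hs : shiftUp s e h (shiftDown s e h j) = j := by
    apply Fin.ext; rw [shiftUp_val hn, if_pos (by omega)]; omega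
  -- The values of the perturbed form are entries of u, so the sum over k is an entry of u * v = 1.
  have e2 : ∀ k, v k i * (t • f + f₀) (single k j 1) = u (shiftDown s e h j) k * v k i := by
    intro k
    by_cases hk : R k i ∨ k = i
    · have hk' : s ≤ (k : ℕ) ∧ (k : ℕ) < s + a := by
        rcases hk with hk | rfl
        · exact ⟨(H.supp _ _ hk).1, H.col _ _ hk h2⟩
        · exact ⟨h1, h2⟩
      rw [mul_comm, hu, Matrix.add_apply, Matrix.smul_apply, hX, if_pos (by omega), hs,
        LinearMap.add_apply, LinearMap.smul_apply, hf₀ k j hk'.1 hk'.2 (by omega) h4, add_comm,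
        Matrix.one_apply]
      congr 2
      refine if_congr ?_ rfl rfl
      rw [Fin.ext_iff]
      omega
    · rw [hvmem k i hk, zero_mul, mul_zero]
  change (t • f + f₀) (v * (single i j 1 * u)) = _
  rw [e1, map_mul_single, Finset.sum_congr rfl fun k _ => e2 k, ← Matrix.mul_apply, huv,
    Matrix.one_apply]
  refine if_congr ?_ rfl rfl
  rw [Fin.ext_iff]
  omega

/-- After a small perturbation and a conjugation, a functional is standard on the corner. -/
theorem exists_std [Infinite K] (f : Matrix (Fin n) (Fin n) K →ₗ[K] K) :
    ∃ f₂ : Matrix (Fin n) (Fin n) K →ₗ[K] K, StdOn s e h a f₂ ∧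
      finrank K (radical (suppMat K R) f₂) ≤ finrank K (radical (suppMat K R) f) := by
  have hle := H.le
  have hn := H.hn
  have ha := H.ha
  obtain ⟨f₁, hf₁, hstd⟩ := H.exists_std_last f
  -- Right multiplication by 1 + N adds to each earlier corner column a combination of the last
  -- ones, chosen to cancel the value of the form there. N is nonzero only if a = e < h.
  let N : Matrix (Fin n) (Fin n) K := Matrix.of fun j l =>
    if s + a ≤ (j : ℕ) ∧ (j : ℕ) < s + h ∧ s + h ≤ (l : ℕ) ∧ (l : ℕ) < s + e + h then
      - f₁ (single (shiftDown s e h l) j 1) else 0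
  have hN : ∀ j l, N j l =
    if s + a ≤ (j : ℕ) ∧ (j : ℕ) < s + h ∧ s + h ≤ (l : ℕ) ∧ (l : ℕ) < s + e + h then
      - f₁ (single (shiftDown s e h l) j 1) else 0 := fun _ _ => rfl
  have hNN : N * N = 0 := by
    ext i j
    rw [Matrix.mul_apply]
    refine Finset.sum_eq_zero fun k _ => ?_
    by_cases hk : (k : ℕ) < s + h
    · rw [hN i k, if_neg (by omega), zero_mul]
    · rw [hN k j, if_neg (by omega), mul_zero]
  have hNmem : ∀ i j, ¬ (R i j ∨ i = j) → (1 : Matrix (Fin n) (Fin n) K) i j = 0 ∧ N i j = 0 := by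
    intro i j hij
    rw [not_or] at hij
    refine ⟨Matrix.one_apply_ne hij.2, ?_⟩
    rw [hN, if_neg]
    intro hc
    exact hij.1 (H.mid _ _ (by omega) hc.2.1 hc.2.2.1 hc.2.2.2)
  have h1 : (1 + N) * (1 - N) = 1 := by
    rw [add_mul, mul_sub, mul_sub, hNN]; simp
  have h2 : (1 - N) * (1 + N) = 1 := by
    rw [sub_mul, mul_add, mul_add, hNN]; simp
  refine ⟨_, ?_, (H.finrank_radical_conj_eq (u := 1 + N) (v := 1 - N) ?_ ?_ h1 h2 f₁).trans_le hf₁⟩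
  · intro i j hi1 hi2 hj1 hj2
    change f₁ ((1 - N) * (single i j 1 * (1 + N))) = _
    have e1 : N * single i j 1 = 0 := by
      ext k l
      by_cases hl : l = j
      · subst hl
        rw [Matrix.mul_single_apply_same, hN, if_neg (by omega)]
        simp
      · rw [Matrix.mul_single_apply_of_ne _ _ _ _ _ hl]
        simp
    have e2 : (1 - N) * (single i j 1 * (1 + N)) = single i j 1 + single i j 1 * N := by
      rw [← mul_assoc, sub_mul, e1, one_mul, sub_zero, mul_add, mul_one]
    rw [e2, map_add, map_single_mul]
    by_cases hj : s + h ≤ (j : ℕ)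
    · rw [hstd i j hi1 hi2 hj hj2, Finset.sum_eq_zero, add_zero]
      intro l _
      rw [hN, if_neg (by omega), zero_mul]
    · have hu := shiftUp_val hn i
      rw [if_pos (by omega)] at hu
      have hs : shiftDown s e h (shiftUp s e h i) = i := by
        apply Fin.ext; rw [shiftDown_val, if_pos (by omega)]; omega
      rw [Finset.sum_eq_single (shiftUp s e h i), hN, if_pos (by omega), hs,
        hstd i (shiftUp s e h i) hi1 hi2 (by omega) (by omega), if_pos hu, if_neg (by omega)]
      · ring
      · intro l _ hl
        by_cases hc : s + h ≤ (l : ℕ) ∧ (l : ℕ) < s + e + h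
        · rw [hstd i l hi1 hi2 hc.1 hc.2, if_neg fun hc' => hl (Fin.ext (by omega)), mul_zero]
        · rw [hN, if_neg (by omega), zero_mul]
      · simp
  · intro i j hij
    rw [Matrix.add_apply, (hNmem i j hij).1, (hNmem i j hij).2, add_zero]
  · intro i j hij
    rw [Matrix.sub_apply, (hNmem i j hij).1, (hNmem i j hij).2, sub_zero]

/-- One step of the reduction preserves the index. -/
theorem hasIndex [Infinite K] {k : ℕ} (hk : HasIndex (suppMat K R') k) :
    HasIndex (suppMat K R) k := by
  refine ⟨H.hasIndex_upper hk, fun f => ?_⟩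
  obtain ⟨f₂, hf₂, hle⟩ := H.exists_std f
  rw [H.finrank_radical_eq hf₂] at hle
  exact (hk.2 _).trans hle

end IsReduction


/-! ### Transposition and direct sums. -/

section

variable {K : Type*} [Field K]

/-- Transposition reverses products, so it only changes the sign of commutators. -/
lemma radical_transpose {ι : Type*} [Fintype ι] [DecidableEq ι] {R : ι → ι → Prop}
    (f : Matrix ι ι K →ₗ[K] K) :
    finrank K (radical (suppMat K fun i j => R j i)
      (f ∘ₗ (Matrix.transposeLinearEquiv ι ι K K).toLinearMap)) =
      finrank K (radical (suppMat K R) f) := by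
  have h : radical (suppMat K R) f = (radical (suppMat K fun i j => R j i)
      (f ∘ₗ (Matrix.transposeLinearEquiv ι ι K K).toLinearMap)).map
        (Matrix.transposeLinearEquiv ι ι K K).toLinearMap := by
    ext x
    constructor
    · rintro ⟨hx, hx'⟩
      refine ⟨xᵀ, ⟨fun i j hij => hx j i hij, fun y hy => ?_⟩, Matrix.transpose_transpose x⟩
      have h := hx' yᵀ fun i j hij => hy j i hij
      change f ((xᵀ * y - y * xᵀ)ᵀ) = 0
      rw [Matrix.transpose_sub, Matrix.transpose_mul, Matrix.transpose_mul,
        Matrix.transpose_transpose, ← neg_sub, map_neg, h, neg_zero]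
    · rintro ⟨x, ⟨hx, hx'⟩, rfl⟩
      refine ⟨fun i j hij => hx j i hij, fun y hy => ?_⟩
      have h : f ((x * yᵀ - yᵀ * x)ᵀ) = 0 := hx' yᵀ fun i j hij => hy j i hij
      change f (xᵀ * y - y * xᵀ) = 0
      rwa [Matrix.transpose_sub, Matrix.transpose_mul, Matrix.transpose_mul,
        Matrix.transpose_transpose, ← neg_sub, map_neg, neg_eq_zero] at h
  rw [h]
  exact (LinearEquiv.finrank_map_eq (Matrix.transposeLinearEquiv ι ι K K) _).symm

theorem HasIndex.transpose {ι : Type*} [Fintype ι] [DecidableEq ι] {R : ι → ι → Prop} {k : ℕ}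
    (h : HasIndex (suppMat K R) k) : HasIndex (suppMat K fun i j => R j i) k := by
  obtain ⟨⟨f, hf⟩, hk⟩ := h
  refine ⟨⟨_, (radical_transpose f).trans_le hf⟩, fun g => ?_⟩
  rw [← radical_transpose (R := fun i j => R j i) g]
  exact hk _

/-- The restriction of a matrix to the positions in a relation. -/
noncomputable def restrictSupp (K : Type*) [Field K] {ι : Type*} (R : ι → ι → Prop) :
    Matrix ι ι K →ₗ[K] Matrix ι ι K :=
  open Classical in
  { toFun := fun x => Matrix.of fun i j => if R i j then x i j else 0
    map_add' := fun x y => by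
      ext i j; simp only [Matrix.of_apply, Matrix.add_apply]; split_ifs <;> simp
    map_smul' := fun c x => by
      ext i j; simp only [Matrix.of_apply, Matrix.smul_apply]; split_ifs <;> simp }

lemma restrictSupp_apply_of {ι : Type*} {R : ι → ι → Prop} (x : Matrix ι ι K) {i j : ι}
    (h : R i j) : restrictSupp K R x i j = x i j := if_pos h

lemma restrictSupp_apply_of_not {ι : Type*} {R : ι → ι → Prop} (x : Matrix ι ι K) {i j : ι}
    (h : ¬ R i j) : restrictSupp K R x i j = 0 := if_neg h

lemma restrictSupp_mem {ι : Type*} {R : ι → ι → Prop} (x : Matrix ι ι K) :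
    restrictSupp K R x ∈ suppMat K R := fun _ _ h => restrictSupp_apply_of_not x h

lemma restrictSupp_eq_self {ι : Type*} {R : ι → ι → Prop} {x : Matrix ι ι K}
    (h : x ∈ suppMat K R) : restrictSupp K R x = x := by
  ext i j
  by_cases hR : R i j
  · exact restrictSupp_apply_of x hR
  · rw [restrictSupp_apply_of_not x hR, h i j hR]

lemma restrictSupp_eq_zero {ι : Type*} {R S : ι → ι → Prop} {x : Matrix ι ι K}
    (h : x ∈ suppMat K S) (hRS : ∀ i j, R i j → ¬ S i j) : restrictSupp K R x = 0 := by
  ext i j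
  by_cases hR : R i j
  · rw [restrictSupp_apply_of x hR, h i j (hRS i j hR)]; rfl
  · rw [restrictSupp_apply_of_not x hR]; rfl

section DirectSum

variable {ι : Type*} [Fintype ι] {R R₁ R₂ : ι → ι → Prop}

lemma mul_eq_zero_of_not_composable {R S : ι → ι → Prop} (h : ∀ i j k, R i j → ¬ S j k)
    {x y : Matrix ι ι K} (hx : x ∈ suppMat K R) (hy : y ∈ suppMat K S) : x * y = 0 := by
  have := suppMat_mul_mem (T := fun _ _ => False) (fun i j k h1 h2 => h i j k h1 h2) hx hy
  ext i j
  exact this i j id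

variable [DecidableEq ι]

/-- All mixed products vanish, so the commutator form is an orthogonal sum. -/
lemma finrank_radical_or (hR : ∀ i j, R i j ↔ R₁ i j ∨ R₂ i j)
    (h12 : ∀ i j k, R₁ i j → ¬ R₂ j k) (h21 : ∀ i j k, R₂ i j → ¬ R₁ j k)
    (hd : ∀ i j, R₁ i j → ¬ R₂ i j) (f : Matrix ι ι K →ₗ[K] K) :
    finrank K (radical (suppMat K R) f) =
      finrank K (radical (suppMat K R₁) f) + finrank K (radical (suppMat K R₂) f) := by
  have hle1 : suppMat K R₁ ≤ suppMat K R := fun x hx i j hij => hx i j fun h =>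
    hij ((hR i j).mpr (Or.inl h))
  have hle2 : suppMat K R₂ ≤ suppMat K R := fun x hx i j hij => hx i j fun h =>
    hij ((hR i j).mpr (Or.inr h))
  have hsum : ∀ x ∈ suppMat K R, restrictSupp K R₁ x + restrictSupp K R₂ x = x := by
    intro x hx
    ext i j
    rw [Matrix.add_apply]
    by_cases h1 : R₁ i j
    · rw [restrictSupp_apply_of x h1, restrictSupp_apply_of_not x (hd i j h1), add_zero]
    · by_cases h2 : R₂ i j
      · rw [restrictSupp_apply_of_not x h1, restrictSupp_apply_of x h2, zero_add]
      · rw [restrictSupp_apply_of_not x h1, restrictSupp_apply_of_not x h2, zero_add,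
          hx i j fun h => ((hR i j).mp h).elim h1 h2]
  have hc : ∀ x₁ ∈ suppMat K R₁, ∀ x₂ ∈ suppMat K R₂, ∀ y₁ ∈ suppMat K R₁, ∀ y₂ ∈ suppMat K R₂,
      (x₁ + x₂) * (y₁ + y₂) - (y₁ + y₂) * (x₁ + x₂) =
        (x₁ * y₁ - y₁ * x₁) + (x₂ * y₂ - y₂ * x₂) := by
    intro x₁ hx₁ x₂ hx₂ y₁ hy₁ y₂ hy₂
    rw [add_mul, add_mul, mul_add, mul_add, mul_add, mul_add,
      mul_eq_zero_of_not_composable h12 hx₁ hy₂, mul_eq_zero_of_not_composable h21 hx₂ hy₁,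
      mul_eq_zero_of_not_composable h12 hy₁ hx₂, mul_eq_zero_of_not_composable h21 hy₂ hx₁]
    abel
  have hsup : radical (suppMat K R) f = radical (suppMat K R₁) f ⊔ radical (suppMat K R₂) f := by
    apply le_antisymm
    · rintro x ⟨hx, hx'⟩
      have m1 := restrictSupp_mem (R := R₁) x
      have m2 := restrictSupp_mem (R := R₂) x
      refine Submodule.mem_sup.mpr ⟨restrictSupp K R₁ x, ⟨m1, fun y hy => ?_⟩,
        restrictSupp K R₂ x, ⟨m2, fun y hy => ?_⟩, hsum x hx⟩
      · have h := hx' y (hle1 hy)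
        have e := hc _ m1 _ m2 y hy 0 (zero_mem _)
        rw [hsum x hx, add_zero, mul_zero, zero_mul, sub_zero, add_zero] at e
        rwa [e] at h
      · have h := hx' y (hle2 hy)
        have e := hc _ m1 _ m2 0 (zero_mem _) y hy
        rw [hsum x hx, zero_add, mul_zero, zero_mul, sub_zero, zero_add] at e
        rwa [e] at h
    · intro x hx
      obtain ⟨x₁, ⟨hx₁, hx₁'⟩, x₂, ⟨hx₂, hx₂'⟩, rfl⟩ := Submodule.mem_sup.mp hx
      refine ⟨add_mem (hle1 hx₁) (hle2 hx₂), fun y hy => ?_⟩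
      have m1 := restrictSupp_mem (R := R₁) y
      have m2 := restrictSupp_mem (R := R₂) y
      rw [← hsum y hy, hc _ hx₁ _ hx₂ _ m1 _ m2, map_add, hx₁' _ m1, hx₂' _ m2, add_zero]
  have hinf : radical (suppMat K R₁) f ⊓ radical (suppMat K R₂) f = ⊥ := by
    rw [eq_bot_iff]
    rintro x ⟨hx₁, hx₂⟩
    rw [Submodule.mem_bot, ← restrictSupp_eq_self hx₁.1]
    exact restrictSupp_eq_zero hx₂.1 hd
  have := Submodule.finrank_sup_add_finrank_inf_eq (radical (suppMat K R₁) f)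
    (radical (suppMat K R₂) f)
  rwa [hinf, finrank_bot, add_zero, ← hsup] at this

/-- The index is additive on direct sums. -/
theorem HasIndex.or {k₁ k₂ : ℕ} (hR : ∀ i j, R i j ↔ R₁ i j ∨ R₂ i j)
    (h12 : ∀ i j k, R₁ i j → ¬ R₂ j k) (h21 : ∀ i j k, R₂ i j → ¬ R₁ j k)
    (hd : ∀ i j, R₁ i j → ¬ R₂ i j)
    (ht1 : ∀ i j k, R₁ i j → R₁ j k → R₁ i k) (ht2 : ∀ i j k, R₂ i j → R₂ j k → R₂ i k)
    (H1 : HasIndex (suppMat K R₁) k₁) (H2 : HasIndex (suppMat K R₂) k₂) :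
    HasIndex (suppMat K R) (k₁ + k₂) := by
  obtain ⟨⟨f₁, hf₁⟩, hk₁⟩ := H1
  obtain ⟨⟨f₂, hf₂⟩, hk₂⟩ := H2
  constructor
  · let f := f₁ ∘ₗ restrictSupp K R₁ + f₂ ∘ₗ restrictSupp K R₂
    have e1 : radical (suppMat K R₁) f = radical (suppMat K R₁) f₁ :=
      radical_congr (fun x hx y hy => suppMat_mul_mem ht1 hx hy) fun x hx => by
        rw [LinearMap.add_apply, LinearMap.comp_apply, LinearMap.comp_apply,
          restrictSupp_eq_self hx, restrictSupp_eq_zero hx fun i j h2 h1 => hd i j h1 h2]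
        simp
    have e2 : radical (suppMat K R₂) f = radical (suppMat K R₂) f₂ :=
      radical_congr (fun x hx y hy => suppMat_mul_mem ht2 hx hy) fun x hx => by
        rw [LinearMap.add_apply, LinearMap.comp_apply, LinearMap.comp_apply,
          restrictSupp_eq_self hx, restrictSupp_eq_zero hx hd]
        simp
    refine ⟨f, ?_⟩
    rw [finrank_radical_or hR h12 h21 hd, e1, e2]
    exact add_le_add hf₁ hf₂
  · intro f
    rw [finrank_radical_or hR h12 h21 hd]
    exact add_le_add (hk₁ f) (hk₂ f)

end DirectSum

end


/-! ### The index of a full matrix algebra. -/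

section FullBlock

variable {K : Type*} [Field K] {n : ℕ} (S : Finset (Fin n))

/-- The relation whose algebra is the full matrix algebra on the indices in `S`. -/
def blockRel (i j : Fin n) : Prop := i ∈ S ∧ j ∈ S

/-- The matrix, supported on the block `S`, representing a functional on this block. -/
def blockGram (f : Matrix (Fin n) (Fin n) K →ₗ[K] K) : Matrix (Fin n) (Fin n) K :=
  Matrix.of fun i j => if i ∈ S ∧ j ∈ S then f (single j i 1) else 0

lemma blockGram_apply (f : Matrix (Fin n) (Fin n) K →ₗ[K] K) (i j : Fin n) :
    blockGram S f i j = if i ∈ S ∧ j ∈ S then f (single j i 1) else 0 := rfl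

lemma blockGram_mem (f : Matrix (Fin n) (Fin n) K →ₗ[K] K) :
    blockGram S f ∈ suppMat K (blockRel S) := fun _ _ h => if_neg h

lemma blockRel_trans : ∀ i j k, blockRel S i j → blockRel S j k → blockRel S i k :=
  fun _ _ _ h1 h2 => ⟨h1.1, h2.2⟩

lemma map_eq_trace_blockGram (f : Matrix (Fin n) (Fin n) K →ₗ[K] K)
    {x : Matrix (Fin n) (Fin n) K} (hx : x ∈ suppMat K (blockRel S)) :
    f x = (blockGram S f * x).trace := by
  let g : Matrix (Fin n) (Fin n) K →ₗ[K] K :=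
    f - Matrix.traceLinearMap (Fin n) K K ∘ₗ LinearMap.mulLeft K (blockGram S f)
  have h : g x = 0 := by
    refine map_eq_zero_of_mem_suppMat g (fun i j hij => ?_) hx
    change f (single i j 1) - (blockGram S f * single i j 1).trace = 0
    rw [Matrix.trace_mul_single, blockGram_apply, if_pos ⟨hij.2, hij.1⟩]
    simp
  exact sub_eq_zero.mp h

/-- The form is the trace against its Gram matrix G, and tr(G[x, y]) = tr([G, x]y), so whatever
commutes with G is in the radical. Exponents start at 1 because the identity need not be supported
on the block. -/
lemma blockGram_pow_mem_radical (f : Matrix (Fin n) (Fin n) K →ₗ[K] K) (k : ℕ) :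
    blockGram S f ^ (k + 1) ∈ radical (suppMat K (blockRel S)) f := by
  have hmem : ∀ k, blockGram S f ^ (k + 1) ∈ suppMat K (blockRel S) := by
    intro k
    induction k with
    | zero => rw [zero_add, pow_one]; exact blockGram_mem S f
    | succ k ih => rw [pow_succ]; exact suppMat_mul_mem (blockRel_trans S) ih (blockGram_mem S f)
  refine ⟨hmem k, fun y hy => ?_⟩
  rw [map_eq_trace_blockGram S f (sub_mem (suppMat_mul_mem (blockRel_trans S) (hmem k) hy)
    (suppMat_mul_mem (blockRel_trans S) hy (hmem k))), mul_sub, Matrix.trace_sub, sub_eq_zero,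
    ← mul_assoc, ← pow_succ', ← mul_assoc, Matrix.trace_mul_comm (_ * y), ← mul_assoc, ← pow_succ]

/-- The functional `x ↦ ∑ i ∈ S, (i + 1) * x i i`. -/
def diagFunctional (K : Type*) [Field K] : Matrix (Fin n) (Fin n) K →ₗ[K] K :=
  -- In characteristic zero the weights i + 1 are distinct, which bounds the radical, and nonzero,
  -- which makes the powers from exponent 1 independent.
  ∑ i ∈ S, ((i : ℕ) + 1 : K) • Matrix.entryLinearMap K K i i

lemma diagFunctional_single (i j : Fin n) :
    diagFunctional S K (single i j 1) = if i ∈ S ∧ i = j then ((i : ℕ) + 1 : K) else 0 := by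
  have : diagFunctional S K (single i j 1) =
      ∑ k ∈ S, ((k : ℕ) + 1 : K) * (single i j 1 : Matrix (Fin n) (Fin n) K) k k := by
    simp [diagFunctional]
  rw [this]
  split_ifs with h
  · obtain ⟨h1, rfl⟩ := h
    rw [Finset.sum_eq_single i]
    · simp
    · intro k _ hk
      rw [single_apply_of_ne _ _ _ _ _ (by simp [hk.symm]), mul_zero]
    · exact fun h => absurd h1 h
  · refine Finset.sum_eq_zero fun k hk => ?_
    rw [single_apply_of_ne, mul_zero]
    rintro ⟨rfl, rfl⟩
    exact h ⟨hk, rfl⟩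

lemma blockGram_diagFunctional : blockGram S (diagFunctional S K) =
    Matrix.diagonal fun i => if i ∈ S then ((i : ℕ) + 1 : K) else 0 := by
  ext i j
  rw [blockGram_apply, diagFunctional_single, Matrix.diagonal_apply]
  by_cases h : i = j
  · subst h; by_cases hi : i ∈ S <;> simp [hi]
  · simp [h, Ne.symm h]

variable [CharZero K]

/-- Pairing with a matrix unit multiplies an off-diagonal entry by a difference of two distinct
weights, so radical elements are diagonal. -/
lemma finrank_radical_diagFunctional_le :
    finrank K (radical (suppMat K (blockRel S)) (diagFunctional S K)) ≤ S.card := by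
  let L : radical (suppMat K (blockRel S)) (diagFunctional S K) →ₗ[K] (S → K) :=
    LinearMap.pi fun i => Matrix.entryLinearMap K K (i : Fin n) (i : Fin n) ∘ₗ Submodule.subtype _
  have hL : ∀ x i, L x i = (x : Matrix (Fin n) (Fin n) K) i i := fun _ _ => rfl
  have hinj : Function.Injective L := by
    rw [← LinearMap.ker_eq_bot, eq_bot_iff]
    rintro ⟨x, hx, hx'⟩ h0
    rw [Submodule.mem_bot]
    refine Subtype.ext ?_
    ext l k
    change x l k = 0
    by_cases hlk : blockRel S l k
    swap
    · exact hx l k hlk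
    by_cases h : l = k
    · subst h
      exact congrFun h0 ⟨l, hlk.1⟩
    · have h1 := hx' _ (single_mem_suppMat (R := blockRel S) ⟨hlk.2, hlk.1⟩ 1)
      rw [map_sub, map_mul_single, map_single_mul, Finset.sum_eq_single l,
        Finset.sum_eq_single k, diagFunctional_single, diagFunctional_single, if_pos ⟨hlk.1, rfl⟩,
        if_pos ⟨hlk.2, rfl⟩, ← mul_sub, mul_eq_zero] at h1
      · refine h1.resolve_right fun h2 => h (Fin.ext ?_)
        rw [add_sub_add_right_eq_sub, sub_eq_zero] at h2
        exact_mod_cast h2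
      · intro j _ hj
        rw [diagFunctional_single, if_neg fun hc => hj hc.2.symm, mul_zero]
      · simp
      · intro j _ hj
        rw [diagFunctional_single, if_neg fun hc => hj hc.2, mul_zero]
      · simp
  have := LinearMap.finrank_le_finrank_of_injective hinj
  simpa using this

/-- The first |S| powers of the Gram matrix are in the radical. Their diagonal entries on S form a
square matrix polynomial in t whose determinant at t = 0 is a Vandermonde determinant times the
product of the weights, hence nonzero. -/
lemma eventually_card_le_finrank_radical (f : Matrix (Fin n) (Fin n) K →ₗ[K] K) :
    ∀ᶠ t : K in cofinite,
      S.card ≤ finrank K (radical (suppMat K (blockRel S)) (t • f + diagFunctional S K)) := by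
  let e : Fin S.card → Fin n := fun i => S.equivFin.symm i
  have he : ∀ i, e i ∈ S := fun i => (S.equivFin.symm i).2
  have heinj : Function.Injective e := Subtype.val_injective.comp S.equivFin.symm.injective
  let G : Matrix (Fin n) (Fin n) (Polynomial K) :=
    (Polynomial.X : Polynomial K) • (blockGram S f).map Polynomial.C +
      (blockGram S (diagFunctional S K)).map Polynomial.C
  have hG : ∀ t, (Polynomial.evalRingHom t).mapMatrix G =
      blockGram S (t • f + diagFunctional S K) := by
    intro t
    ext i j
    simp only [G, RingHom.mapMatrix_apply, Matrix.map_apply, Matrix.add_apply, Matrix.smul_apply,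
      smul_eq_mul, map_add, Polynomial.coe_evalRingHom,
      Polynomial.eval_C, blockGram_apply, LinearMap.add_apply, LinearMap.smul_apply]
    split_ifs
    · simp
      ring
    · simp
  let P : Matrix (Fin S.card) (Fin S.card) (Polynomial K) :=
    Matrix.of fun k l => (G ^ ((k : ℕ) + 1)) (e l) (e l)
  have hP : ∀ t, P.det.eval t = (Matrix.of fun k l : Fin S.card =>
      (blockGram S (t • f + diagFunctional S K) ^ ((k : ℕ) + 1)) (e l) (e l)).det := by
    intro t
    rw [← Polynomial.coe_evalRingHom, RingHom.map_det]
    congr 1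
    ext k l
    have h := congrFun (congrFun (map_pow (Polynomial.evalRingHom t).mapMatrix G ((k : ℕ) + 1))
      (e l)) (e l)
    rw [hG] at h
    exact h
  have hP0 : P.det ≠ 0 := by
    intro h
    have h0 := hP 0
    rw [h, Polynomial.eval_zero, zero_smul, zero_add, blockGram_diagFunctional] at h0
    have h1 : (Matrix.of fun k l : Fin S.card =>
        ((Matrix.diagonal fun i => if i ∈ S then ((i : ℕ) + 1 : K) else 0) ^ ((k : ℕ) + 1))
          (e l) (e l)) = (Matrix.of fun l k : Fin S.card =>
            (((e l : ℕ) : K) + 1) * Matrix.vandermonde (fun l => ((e l : ℕ) : K) + 1) l k)ᵀ := by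
      ext k l
      rw [Matrix.of_apply, Matrix.diagonal_pow, Matrix.diagonal_apply_eq, Matrix.transpose_apply,
        Matrix.of_apply, Matrix.vandermonde_apply, Pi.pow_apply, if_pos (he l), pow_succ']
    rw [h1, Matrix.det_transpose, Matrix.det_mul_column] at h0
    have h2 : (∏ l, (((e l : ℕ) : K) + 1)) ≠ 0 :=
      Finset.prod_ne_zero_iff.mpr fun l _ => Nat.cast_add_one_ne_zero _
    refine (mul_ne_zero h2 (Matrix.det_vandermonde_ne_zero_iff.mpr ?_)) h0.symm
    intro l l' hl
    apply heinj
    apply Fin.ext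
    have : ((e l : ℕ) : K) + 1 = ((e l' : ℕ) : K) + 1 := hl
    exact_mod_cast add_right_cancel this
  classical
  refine Filter.mem_of_superset (P.det.roots.toFinset.finite_toSet.compl_mem_cofinite) ?_
  intro t ht
  have hdet : (Matrix.of fun k l : Fin S.card =>
      (blockGram S (t • f + diagFunctional S K) ^ ((k : ℕ) + 1)) (e l) (e l)).det ≠ 0 := by
    rw [← hP]
    intro h
    exact ht (by simpa [hP0] using h)
  have hli := Matrix.linearIndependent_rows_of_det_ne_zero hdet
  let w : Fin S.card → radical (suppMat K (blockRel S)) (t • f + diagFunctional S K) := fun k =>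
    ⟨_, blockGram_pow_mem_radical S (t • f + diagFunctional S K) k⟩
  let L : radical (suppMat K (blockRel S)) (t • f + diagFunctional S K) →ₗ[K]
      (Fin S.card → K) :=
    LinearMap.pi fun l => Matrix.entryLinearMap K K (e l) (e l) ∘ₗ Submodule.subtype _
  have hw : LinearIndependent K w := LinearIndependent.of_comp L hli
  simpa using hw.fintype_card_le_finrank

/-- The index of a full matrix algebra is its size. -/
theorem hasIndex_blockRel : HasIndex (suppMat K (blockRel S)) S.card := by
  refine ⟨⟨_, finrank_radical_diagFunctional_le S⟩, fun f => ?_⟩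
  obtain ⟨t, h1, h2⟩ := ((eventually_finrank_radical_le (suppMat K (blockRel S)) f
    (diagFunctional S K)).and (eventually_card_le_finrank_radical S f)).exists
  exact h2.trans h1

end FullBlock


/-! ### Seaweeds as support relations, and the reduction on block lists. -/

/-- For consecutive intervals of lengths `l` starting at `s`, the interval containing `i` does not
come after the interval containing `j`. -/
def blockLe : ℕ → List ℕ → ℕ → ℕ → Prop
  | _, [], _, _ => True
  | s, c :: l, i, j => (j < s + c → i < s + c) ∧ blockLe (s + c) l i j

lemma blockLe_of_le {i j : ℕ} (h : i ≤ j) : ∀ (s : ℕ) (l : List ℕ), blockLe s l i j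
  | _, [] => trivial
  | s, c :: l => ⟨fun h' => by omega, blockLe_of_le h (s + c) l⟩

lemma blockLe_of_lt {i j : ℕ} : ∀ (s : ℕ) (l : List ℕ), i < s → blockLe s l i j
  | _, [], _ => trivial
  | s, c :: l, h => ⟨fun _ => by omega, blockLe_of_lt (s + c) l (by omega)⟩

lemma blockLe_trans {i j k : ℕ} : ∀ (s : ℕ) (l : List ℕ), blockLe s l i j → blockLe s l j k →
    blockLe s l i k
  | _, [], _, _ => trivial
  | s, c :: l, h1, h2 => ⟨fun h => h1.1 (h2.1 h), blockLe_trans (s + c) l h1.2 h2.2⟩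

/-- The positions of the nonzero entries in the seaweed algebra attached to lists `l`, `m` of block
sizes, with indices starting at `s`. -/
def seaRel (n s : ℕ) (l m : List ℕ) (i j : Fin n) : Prop :=
  s ≤ (i : ℕ) ∧ s ≤ (j : ℕ) ∧ blockLe s l i j ∧ blockLe s m j i

lemma seaRel_trans {n s : ℕ} {l m : List ℕ} :
    ∀ i j k, seaRel n s l m i j → seaRel n s l m j k → seaRel n s l m i k :=
  fun _ _ _ h1 h2 => ⟨h1.1, h2.2.1, blockLe_trans _ _ h1.2.2.1 h2.2.2.1,
    blockLe_trans _ _ h2.2.2.2 h1.2.2.2⟩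

lemma seaRel_swap {n s : ℕ} {l m : List ℕ} (i j : Fin n) :
    seaRel n s l m i j ↔ seaRel n s m l j i := by
  unfold seaRel
  tauto

/-- `Defect l m k`: the seaweed algebra of `gl n` with lists of block sizes `l` and `m` has index
`n - k`, as computed by the reduction of meanders. -/
inductive Defect : List ℕ → List ℕ → ℕ → Prop
  -- The counter adds up the sizes removed by reduction steps. `cons` splits off a full matrix
  -- algebra, whose index is its size, and leaves the counter unchanged.
  | nil : Defect [] [] 0
  | cons {a : ℕ} {l m : List ℕ} {k : ℕ} : Defect l m k → Defect (a :: l) (a :: m) k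
  | double {a b : ℕ} {l m : List ℕ} {k : ℕ} : 0 < a → b = 2 * a → Defect l (a :: m) k →
      Defect (a :: l) (b :: m) (k + a)
  | short {a b c : ℕ} {l m : List ℕ} {k : ℕ} : 0 < a → 0 < c → b = 2 * a + c →
      Defect l (c :: a :: m) k → Defect (a :: l) (b :: m) (k + a)
  | long {a b c e : ℕ} {l m : List ℕ} {k : ℕ} : 0 < e → 0 < c → a = c + e → b = a + e →
      Defect (c :: l) (a :: m) k → Defect (a :: l) (b :: m) (k + e)
  | swap {a b : ℕ} {l m : List ℕ} {k : ℕ} : b < a → Defect (b :: m) (a :: l) k →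
      Defect (a :: l) (b :: m) k

/-- Here e = h = a: the corner is square and there is no middle part. -/
lemma isReduction_double {n s a b : ℕ} {l m : List ℕ} (hb : b = 2 * a) (hn : s + b ≤ n) :
    IsReduction s a a a (seaRel n s (a :: l) (b :: m)) (seaRel n (s + a) l (a :: m)) where
  le := le_rfl
  hn := by omega
  ha := Or.inl rfl
  supp i j h := ⟨h.1, h.2.1⟩
  row i j h1 h2 := by
    constructor
    · rintro ⟨_, h3, _, h4, _⟩
      exact ⟨h3, by omega⟩
    · rintro ⟨h3, h4⟩
      exact ⟨h1, h3, ⟨fun _ => h2, blockLe_of_lt _ _ h2⟩, fun _ => by omega,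
        blockLe_of_lt _ _ (by omega)⟩
  col i j h := h.2.2.1.1
  row' i j h h1 h2 := by
    have := h.2.2.1.1
    have := h.2.2.2.1
    omega
  mid i j h1 h2 h3 h4 := by omega
  trans := seaRel_trans
  red i j := by
    have e : s + b = s + a + a := by omega
    simp only [seaRel, blockLe, e]
    constructor
    · rintro ⟨h1, h2, h3, h4, h5⟩
      exact ⟨h1, h2, ⟨by omega, by omega, ⟨by omega, h3⟩, h4, h5⟩, by omega⟩
    · rintro ⟨h1, h2, ⟨_, _, ⟨_, h3⟩, h4, h5⟩, _⟩
      exact ⟨h1, h2, h3, h4, h5⟩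

lemma isReduction_short {n s a b c : ℕ} {l m : List ℕ} (hb : b = 2 * a + c) (hn : s + b ≤ n) :
    IsReduction s a (a + c) a (seaRel n s (a :: l) (b :: m))
      (seaRel n (s + a) l (c :: a :: m)) where
  le := by omega
  hn := by omega
  ha := Or.inl rfl
  supp i j h := ⟨h.1, h.2.1⟩
  row i j h1 h2 := by
    constructor
    · rintro ⟨_, h3, _, h4, _⟩
      exact ⟨h3, by omega⟩
    · rintro ⟨h3, h4⟩
      exact ⟨h1, h3, ⟨fun _ => h2, blockLe_of_lt _ _ h2⟩, fun _ => by omega,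
        blockLe_of_lt _ _ (by omega)⟩
  col i j h := h.2.2.1.1
  row' i j h h1 h2 := by
    have := h.2.2.1.1
    have := h.2.2.2.1
    omega
  mid i j h1 h2 h3 h4 :=
    ⟨by omega, by omega, blockLe_of_le (by omega) _ _, fun _ => by omega,
      blockLe_of_lt _ _ (by omega)⟩
  trans := seaRel_trans
  red i j := by
    have e : s + b = s + a + c + a := by omega
    simp only [seaRel, blockLe, e, true_and]
    constructor
    · rintro ⟨h1, h2, h3, h4, h5, h6⟩
      exact ⟨h1, h2, ⟨by omega, by omega, ⟨by omega, h3⟩, h5, h6⟩, by omega⟩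
    · rintro ⟨h1, h2, ⟨_, _, ⟨_, h3⟩, h5, h6⟩, _⟩
      exact ⟨h1, h2, h3, by omega, h5, h6⟩

/-- Here h = a and the corner has only e = b - a columns; both first blocks shrink by e. -/
lemma isReduction_long {n s a b c e : ℕ} {l m : List ℕ} (hc : 0 < c) (ha : a = c + e)
    (hb : b = a + e) (hn : s + b ≤ n) (hle : e ≤ a) :
    IsReduction s e a a (seaRel n s (a :: l) (b :: m))
      (seaRel n (s + e) (c :: l) (a :: m)) where
  le := hle
  hn := by omega
  ha := Or.inr rfl
  supp i j h := ⟨h.1, h.2.1⟩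
  row i j h1 h2 := by
    constructor
    · rintro ⟨_, h3, _, h4, _⟩
      exact ⟨h3, by omega⟩
    · rintro ⟨h3, h4⟩
      exact ⟨h1, h3, ⟨fun _ => h2, blockLe_of_lt _ _ h2⟩, fun _ => by omega,
        blockLe_of_lt _ _ (by omega)⟩
  col i j h := h.2.2.1.1
  row' i j h h1 h2 := by
    have := h.2.2.1.1
    have := h.2.2.2.1
    omega
  mid i j h1 h2 h3 h4 :=
    ⟨by omega, by omega, blockLe_of_le (by omega) _ _, fun _ => by omega,
      blockLe_of_lt _ _ (by omega)⟩
  trans := seaRel_trans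
  red i j := by
    have e1 : s + b = s + e + a := by omega
    have e2 : s + a = s + e + c := by omega
    simp only [seaRel, blockLe, e1, e2]
    constructor
    · rintro ⟨h1, h2, ⟨h3, h4⟩, h5, h6⟩
      exact ⟨h1, h2, ⟨by omega, by omega, ⟨h3, h4⟩, h5, h6⟩, by omega⟩
    · rintro ⟨h1, h2, ⟨_, _, ⟨h3, h4⟩, h5, h6⟩, _⟩
      exact ⟨h1, h2, ⟨h3, h4⟩, h5, h6⟩

/-- The index of a seaweed subalgebra of `gl n`. -/
theorem Defect.hasIndex {K : Type*} [Field K] [CharZero K] {n : ℕ} {l m : List ℕ} {k : ℕ}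
    (hD : Defect l m k) : ∀ s, s + l.sum = n → s + m.sum = n →
      ∃ r, r + k + s = n ∧ HasIndex (suppMat K (seaRel n s l m)) r := by
  induction hD with
  | nil =>
    intro s hs _
    refine ⟨0, by simpa using hs, ?_⟩
    have hS := hasIndex_blockRel (K := K) (n := n) ∅
    rw [Finset.card_empty] at hS
    convert hS using 2
    ext i j
    have := i.2
    simp only [List.sum_nil] at hs
    simp only [seaRel, blockRel, Finset.notMem_empty, false_and, iff_false]
    omega
  | @cons a l m k _ ih =>
    intro s hl hm
    rw [List.sum_cons] at hl hm
    obtain ⟨r, hr, hidx⟩ := ih (s + a) (by omega) (by omega)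
    refine ⟨a + r, by omega, ?_⟩
    -- Equal first parts decompose the algebra into the full one on these a indices and the seaweed
    -- on the later ones.
    let S : Finset (Fin n) := Finset.univ.filter fun i => s ≤ (i : ℕ) ∧ (i : ℕ) < s + a
    have hS : ∀ i, i ∈ S ↔ s ≤ (i : ℕ) ∧ (i : ℕ) < s + a := fun i => by simp [S]
    have hcard : S.card = a := by
      have : S.map Fin.valEmbedding = Finset.Ico s (s + a) := by
        ext i
        simp only [Finset.mem_map, Fin.valEmbedding_apply, Finset.mem_Ico]
        constructor
        · rintro ⟨j, hj, rfl⟩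
          exact (hS j).mp hj
        · intro h
          exact ⟨⟨i, by omega⟩, (hS _).mpr h, rfl⟩
      rw [← Finset.card_map, this, Nat.card_Ico]
      omega
    have hblock := hasIndex_blockRel (K := K) S
    rw [hcard] at hblock
    refine HasIndex.or ?_ ?_ ?_ ?_ (blockRel_trans S) seaRel_trans hblock hidx
    · intro i j
      simp only [blockRel, hS, seaRel, blockLe]
      constructor
      · rintro ⟨h1, h2, ⟨h3, h4⟩, h5, h6⟩
        by_cases hi : (i : ℕ) < s + a
        · exact Or.inl ⟨⟨h1, hi⟩, h2, h5 hi⟩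
        · exact Or.inr ⟨by omega, by omega, h4, h6⟩
      · rintro (⟨⟨h1, h2⟩, h3, h4⟩ | ⟨h1, h2, h3, h4⟩)
        · exact ⟨h1, h3, ⟨fun _ => h2, blockLe_of_lt _ _ h2⟩, fun _ => h4, blockLe_of_lt _ _ h4⟩
        · exact ⟨by omega, by omega, ⟨by omega, h3⟩, by omega, h4⟩
    · rintro i j k ⟨_, h1⟩ ⟨h2, _⟩
      rw [hS] at h1
      omega
    · rintro i j k ⟨_, h1, _⟩ ⟨h2, _⟩
      rw [hS] at h2
      omega
    · rintro i j ⟨_, h1⟩ ⟨_, h2, _⟩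
      rw [hS] at h1
      omega
  | @double a b l m k ha hb _ ih =>
    intro s hl hm
    simp only [List.sum_cons] at hl hm ih
    obtain ⟨r, hr, hidx⟩ := ih (s + a) (by omega) (by omega)
    exact ⟨r, by omega, (isReduction_double hb (by omega)).hasIndex hidx⟩
  | @short a b c l m k ha hc hb _ ih =>
    intro s hl hm
    simp only [List.sum_cons] at hl hm ih
    obtain ⟨r, hr, hidx⟩ := ih (s + a) (by omega) (by omega)
    exact ⟨r, by omega, (isReduction_short hb (by omega)).hasIndex hidx⟩
  | @long a b c e l m k he hc ha hb _ ih =>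
    intro s hl hm
    simp only [List.sum_cons] at hl hm ih
    obtain ⟨r, hr, hidx⟩ := ih (s + e) (by omega) (by omega)
    exact ⟨r, by omega, (isReduction_long hc ha hb (by omega) (by omega)).hasIndex hidx⟩
  | @swap a b l m k _ _ ih =>
    intro s hl hm
    obtain ⟨r, hr, hidx⟩ := ih s hm hl
    refine ⟨r, hr, ?_⟩
    have h : seaRel n s (a :: l) (b :: m) = fun i j => seaRel n s (b :: m) (a :: l) j i :=
      funext₂ fun i j => propext (seaRel_swap i j)
    rw [h]
    exact hidx.transpose

/-- Every rule except `swap` lowers the total. A swap is needed only to reach the case of a smaller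
first part on the left, hence that case is isolated in `key`. -/
theorem exists_defect : ∀ (N : ℕ) (l m : List ℕ), (∀ x ∈ l, 0 < x) → (∀ x ∈ m, 0 < x) →
    l.sum = N → m.sum = N → ∃ k, Defect l m k := by
  intro N
  induction N using Nat.strong_induction_on with
  | _ N ih =>
    have key : ∀ (a b : ℕ) (l m : List ℕ), a < b → (∀ x ∈ a :: l, 0 < x) →
        (∀ x ∈ b :: m, 0 < x) → (a :: l).sum = N → (b :: m).sum = N →
        ∃ k, Defect (a :: l) (b :: m) k := by
      intro a b l m hab hl hm hlN hmN
      simp only [List.mem_cons, forall_eq_or_imp, List.sum_cons] at hl hm hlN hmN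
      rcases lt_trichotomy (2 * a) b with h | h | h
      · obtain ⟨k, hk⟩ := ih (N - a) (by omega) l ((b - 2 * a) :: a :: m) hl.2
          (by simp only [List.mem_cons, forall_eq_or_imp]; exact ⟨by omega, hl.1, hm.2⟩)
          (by omega) (by simp only [List.sum_cons]; omega)
        exact ⟨_, Defect.short hl.1 (by omega) (by omega) hk⟩
      · obtain ⟨k, hk⟩ := ih (N - a) (by omega) l (a :: m) hl.2
          (by simp only [List.mem_cons, forall_eq_or_imp]; exact ⟨hl.1, hm.2⟩)
          (by omega) (by simp only [List.sum_cons]; omega)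
        exact ⟨_, Defect.double hl.1 h.symm hk⟩
      · obtain ⟨k, hk⟩ := ih (N - (b - a)) (by omega) ((2 * a - b) :: l) (a :: m)
          (by simp only [List.mem_cons, forall_eq_or_imp]; exact ⟨by omega, hl.2⟩)
          (by simp only [List.mem_cons, forall_eq_or_imp]; exact ⟨hl.1, hm.2⟩)
          (by simp only [List.sum_cons]; omega) (by simp only [List.sum_cons]; omega)
        exact ⟨_, Defect.long (e := b - a) (by omega) (c := 2 * a - b) (by omega) (by omega)
          (by omega) hk⟩
    rintro (_ | ⟨a, l⟩) (_ | ⟨b, m⟩) hl hm hlN hmN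
    · exact ⟨0, Defect.nil⟩
    · have := hm b (by simp)
      simp only [List.sum_nil, List.sum_cons] at hlN hmN
      omega
    · have := hl a (by simp)
      simp only [List.sum_nil, List.sum_cons] at hlN hmN
      omega
    · rcases lt_trichotomy a b with h | rfl | h
      · exact key a b l m h hl hm hlN hmN
      · have ha := hl a (by simp)
        simp only [List.mem_cons, forall_eq_or_imp, List.sum_cons] at hl hm hlN hmN
        obtain ⟨k, hk⟩ := ih (N - a) (by omega) l m hl.2 hm.2 (by omega) (by omega)
        exact ⟨k, Defect.cons hk⟩
      · obtain ⟨k, hk⟩ := key b a m l h hm hl hmN hlN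
        exact ⟨k, Defect.swap h hk⟩


/-! ### From support relations to seaweeds in sl(n). -/

lemma blockLe_iff (i j : ℕ) : ∀ (s : ℕ) (l : List ℕ), blockLe s l i j ↔
    ∀ k < l.length, j < s + (l.take (k + 1)).sum → i < s + (l.take (k + 1)).sum
  | s, [] => by simp [blockLe]
  | s, c :: l => by
    rw [blockLe, blockLe_iff i j (s + c) l]
    simp only [List.length_cons, List.take_succ_cons, List.sum_cons, ← add_assoc]
    constructor
    · rintro ⟨h1, h2⟩ (_ | k) hk
      · simpa using h1
      · exact h2 k (by omega)
    · intro h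
      exact ⟨by simpa using h 0 (by omega), fun k hk => h (k + 1) (by omega)⟩

lemma blockLe_composition_iff {n : ℕ} (a : Composition n) (i j : ℕ) :
    blockLe 0 a.blocks i j ↔ ∀ k ≤ a.length, j < a.sizeUpTo k → i < a.sizeUpTo k := by
  rw [blockLe_iff]
  simp only [zero_add]
  constructor
  · rintro h (_ | k) hk
    · simp [Composition.sizeUpTo]
    · exact h k hk
  · exact fun h k hk => h (k + 1) hk

section

variable {K : Type*} [Field K] {n : ℕ}

lemma mem_span_single_iff (T : Set (Fin n)) (v : Fin n → K) :
    v ∈ Submodule.span K ((fun j : Fin n => (Pi.single j 1 : Fin n → K)) '' T) ↔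
      ∀ i ∉ T, v i = 0 := by
  constructor
  · intro hv i hi
    have h : Submodule.span K ((fun j : Fin n => (Pi.single j 1 : Fin n → K)) '' T) ≤
        LinearMap.ker (LinearMap.proj i : (Fin n → K) →ₗ[K] K) := by
      rw [Submodule.span_le]
      rintro _ ⟨j, hj, rfl⟩
      have : i ≠ j := fun h => hi (h ▸ hj)
      simp [this]
    exact h hv
  · intro hv
    rw [pi_eq_sum_univ' v]
    refine Submodule.sum_mem _ fun i _ => ?_
    by_cases hi : i ∈ T
    · refine Submodule.smul_mem _ _ (Submodule.subset_span ⟨i, hi, ?_⟩)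
      ext j
      simp [Pi.single_apply, eq_comm]
    · rw [hv i hi, zero_smul]
      exact zero_mem _

lemma preserves_span_single_iff (T : Set (Fin n)) (x : Matrix (Fin n) (Fin n) K) :
    Preserves x (Submodule.span K ((fun j : Fin n => (Pi.single j 1 : Fin n → K)) '' T)) ↔
      ∀ i j, j ∈ T → i ∉ T → x i j = 0 := by
  unfold Preserves
  simp only [mem_span_single_iff]
  constructor
  · intro h i j hj hi
    have := h (Pi.single j 1) (fun k hk => by
      have : k ≠ j := fun h => hk (h ▸ hj)
      simp [this]) i hi
    simpa using this
  · intro h v hv i hi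
    change ∑ j, x i j * v j = 0
    refine Finset.sum_eq_zero fun j _ => ?_
    by_cases hj : j ∈ T
    · rw [h i j hj hi, zero_mul]
    · rw [hv j hj, mul_zero]

lemma mem_seaweed_iff (a b : Composition n) (x : LieAlgebra.SpecialLinear.sl (Fin n) K) :
    x ∈ seaweed K a b ↔
      (x : Matrix (Fin n) (Fin n) K) ∈ suppMat K (seaRel n 0 a.blocks b.blocks) := by
  change ((∀ i ≤ a.length, Preserves (x : Matrix (Fin n) (Fin n) K) (flagV K a i)) ∧
    (∀ i ≤ b.length, Preserves (x : Matrix (Fin n) (Fin n) K) (flagW K b i))) ↔ _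
  simp only [flagV, flagW, preserves_span_single_iff, mem_suppMat, seaRel,
    blockLe_composition_iff, Set.mem_ofPred_eq]
  constructor
  · rintro ⟨h1, h2⟩ i j hij
    by_contra hne
    refine hij ⟨Nat.zero_le _, Nat.zero_le _, fun k hk hj => ?_, fun k hk hi => ?_⟩
    · by_contra hi
      exact hne (h1 k hk i j hj hi)
    · by_contra hj
      exact hne (h2 k hk i j (not_lt.mp hj) (not_le.mpr hi))
  · intro h
    refine ⟨fun k hk i j hj hi => h i j fun hc => hi (hc.2.2.1 k hk hj), fun k hk i j hj hi =>
      h i j fun hc => ?_⟩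
    exact absurd (hc.2.2.2 k hk (not_le.mp hi)) (not_lt.mpr hj)

/-- The inclusion of a seaweed algebra into the space of matrices. -/
def seaweedIncl (K : Type*) [Field K] (a b : Composition n) :
    seaweed K a b →ₗ[K] Matrix (Fin n) (Fin n) K where
  toFun x := ((x : LieAlgebra.SpecialLinear.sl (Fin n) K) : Matrix (Fin n) (Fin n) K)
  map_add' _ _ := rfl
  map_smul' _ _ := rfl

lemma seaweedIncl_injective (a b : Composition n) : Function.Injective (seaweedIncl K a b) :=
  fun _ _ h => Subtype.ext (Subtype.ext h)

lemma exists_seaweedIncl_eq_iff (a b : Composition n) (x : Matrix (Fin n) (Fin n) K) :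
    (∃ y, seaweedIncl K a b y = x) ↔
      x ∈ suppMat K (seaRel n 0 a.blocks b.blocks) ∧ x.trace = 0 := by
  constructor
  · rintro ⟨y, rfl⟩
    exact ⟨(mem_seaweed_iff a b y.1).mp y.2, y.1.2⟩
  · rintro ⟨h1, h2⟩
    exact ⟨⟨⟨x, h2⟩, (mem_seaweed_iff a b ⟨x, h2⟩).mpr h1⟩, rfl⟩

/-- The trace of 1 is n ≠ 0 in K, so scalars complement the traceless matrices; being central they
lie in every radical and do not affect commutators. -/
lemma finrank_radical_eq_finrank_ker_add_one [CharZero K] (hn : 0 < n) (a b : Composition n)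
    (g : Matrix (Fin n) (Fin n) K →ₗ[K] K) :
    finrank K (radical (suppMat K (seaRel n 0 a.blocks b.blocks)) g) =
      finrank K (LinearMap.ker (kirillovForm (g ∘ₗ seaweedIncl K a b))) + 1 := by
  set q := suppMat K (seaRel n 0 a.blocks b.blocks) with hq
  set N := (LinearMap.ker (kirillovForm (g ∘ₗ seaweedIncl K a b))).map (seaweedIncl K a b) with hN
  have hNmem : ∀ x, x ∈ N ↔ (x ∈ q ∧ x.trace = 0) ∧
      ∀ y ∈ q, y.trace = 0 → g (x * y - y * x) = 0 := by
    intro x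
    constructor
    · rintro ⟨x, hx, rfl⟩
      refine ⟨(exists_seaweedIncl_eq_iff a b _).mp ⟨x, rfl⟩, fun y hy hy' => ?_⟩
      obtain ⟨y, rfl⟩ := (exists_seaweedIncl_eq_iff a b y).mpr ⟨hy, hy'⟩
      exact LinearMap.congr_fun hx y
    · rintro ⟨hx, hx'⟩
      obtain ⟨x, rfl⟩ := (exists_seaweedIncl_eq_iff a b x).mpr hx
      refine ⟨x, LinearMap.ext fun y => ?_, rfl⟩
      have hy := (exists_seaweedIncl_eq_iff a b _).mp ⟨y, rfl⟩
      exact hx' _ hy.1 hy.2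
  have hone : (1 : Matrix (Fin n) (Fin n) K) ∈ q := by
    intro i j hij
    refine Matrix.one_apply_ne fun h => hij ?_
    subst h
    exact ⟨Nat.zero_le _, Nat.zero_le _, blockLe_of_le le_rfl _ _, blockLe_of_le le_rfl _ _⟩
  have htr1 : (1 : Matrix (Fin n) (Fin n) K).trace ≠ 0 := by
    rw [Matrix.trace_one, Fintype.card_fin]
    exact_mod_cast hn.ne'
  have hsplit : ∀ x ∈ q, ∃ c : K, x - c • 1 ∈ q ∧ (x - c • 1).trace = 0 := by
    intro x hx
    refine ⟨x.trace / (1 : Matrix (Fin n) (Fin n) K).trace,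
      sub_mem hx (Submodule.smul_mem _ _ hone), ?_⟩
    rw [Matrix.trace_sub, Matrix.trace_smul, smul_eq_mul, div_mul_cancel₀ _ htr1, sub_self]
  have hcomm : ∀ (x y : Matrix (Fin n) (Fin n) K) (c d : K),
      (x - c • 1) * (y - d • 1) - (y - d • 1) * (x - c • 1) = x * y - y * x := by
    intro x y c d
    simp only [sub_mul, mul_sub, smul_mul_assoc, mul_smul_comm, one_mul, mul_one, smul_sub,
      smul_comm d c]
    abel
  have hsup : radical q g = N ⊔ Submodule.span K {(1 : Matrix (Fin n) (Fin n) K)} := by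
    ext x
    rw [Submodule.mem_sup]
    constructor
    · rintro ⟨hx, hx'⟩
      obtain ⟨c, hc1, hc2⟩ := hsplit x hx
      refine ⟨x - c • 1, (hNmem _).mpr ⟨⟨hc1, hc2⟩, fun y hy _ => ?_⟩, c • 1,
        Submodule.smul_mem _ _ (Submodule.mem_span_singleton_self _), sub_add_cancel _ _⟩
      have := hcomm x y c 0
      rw [zero_smul, sub_zero] at this
      rw [this]
      exact hx' y hy
    · rintro ⟨x, hx, z, hz, rfl⟩
      obtain ⟨c, rfl⟩ := Submodule.mem_span_singleton.mp hz
      obtain ⟨⟨hx1, _⟩, hx2⟩ := (hNmem x).mp hx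
      refine ⟨add_mem hx1 (Submodule.smul_mem _ _ hone), fun y hy => ?_⟩
      obtain ⟨d, hd1, hd2⟩ := hsplit y hy
      have h1 := hx2 _ hd1 hd2
      have h2 := hcomm x y 0 d
      have h3 := hcomm x y (-c) 0
      rw [zero_smul, sub_zero] at h2 h3
      rw [neg_smul, sub_neg_eq_add] at h3
      rw [h3, ← h2, h1]
  have hinf : N ⊓ Submodule.span K {(1 : Matrix (Fin n) (Fin n) K)} = ⊥ := by
    rw [eq_bot_iff]
    rintro x ⟨hx, hx'⟩
    obtain ⟨c, rfl⟩ := Submodule.mem_span_singleton.mp hx'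
    have h := ((hNmem _).mp hx).1.2
    rw [Matrix.trace_smul, smul_eq_mul] at h
    rw [Submodule.mem_bot, (mul_eq_zero.mp h).resolve_right htr1, zero_smul]
  have h1 := Submodule.finrank_sup_add_finrank_inf_eq N
    (Submodule.span K {(1 : Matrix (Fin n) (Fin n) K)})
  rw [hinf, finrank_bot, add_zero, ← hsup,
    finrank_span_singleton (fun h => htr1 (by rw [h, Matrix.trace_zero]))] at h1
  rw [h1, hN]
  congr 1
  exact (LinearEquiv.finrank_eq
    (Submodule.equivMapOfInjective _ (seaweedIncl_injective a b) _)).symm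

lemma lieIndex_add_one [CharZero K] (hn : 0 < n) (a b : Composition n) {r : ℕ}
    (hr : HasIndex (suppMat K (seaRel n 0 a.blocks b.blocks)) r) :
    lieIndex K (seaweed K a b) + 1 = r := by
  obtain ⟨⟨g, hg⟩, hle⟩ := hr
  have hext : ∀ f : Dual K (seaweed K a b), ∃ g : Matrix (Fin n) (Fin n) K →ₗ[K] K,
      g ∘ₗ seaweedIncl K a b = f := by
    intro f
    obtain ⟨p, hp⟩ := LinearMap.exists_leftInverse_of_injective (seaweedIncl K a b)
      (LinearMap.ker_eq_bot.mpr (seaweedIncl_injective a b))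
    exact ⟨f ∘ₗ p, by rw [LinearMap.comp_assoc, hp, LinearMap.comp_id]⟩
  apply le_antisymm
  · rw [finrank_radical_eq_finrank_ker_add_one hn] at hg
    refine le_trans (Nat.add_le_add_right ?_ 1) hg
    exact ciInf_le (OrderBot.bddBelow _) (g ∘ₗ seaweedIncl K a b)
  · have : r - 1 ≤ lieIndex K (seaweed K a b) := by
      refine le_ciInf fun f => ?_
      obtain ⟨g, rfl⟩ := hext f
      have := hle g
      rw [finrank_radical_eq_finrank_ker_add_one hn] at this
      omega
    omega

/-- The index of a seaweed subalgebra of `sl n`, in terms of the reduction of meanders. -/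
theorem lieIndex_seaweed_eq_iff [CharZero K] (hn : 3 ≤ n) (a b : Composition n) :
    lieIndex K (seaweed K a b) = n - 3 ↔ Defect a.blocks b.blocks 2 := by
  have key : ∀ k, Defect a.blocks b.blocks k → lieIndex K (seaweed K a b) + 1 + k = n := by
    intro k hk
    obtain ⟨r, hr, hidx⟩ := hk.hasIndex (K := K) 0 ((zero_add _).trans a.blocks_sum)
      ((zero_add _).trans b.blocks_sum)
    have := lieIndex_add_one (by omega) a b hidx
    omega
  constructor
  · intro h
    -- Existence of some defect suffices: `key` then determines its value from the index.
    obtain ⟨k, hk⟩ := exists_defect n a.blocks b.blocks (fun x hx => a.blocks_pos hx)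
      (fun x hx => b.blocks_pos hx) a.blocks_sum b.blocks_sum
    have := key k hk
    obtain rfl : k = 2 := by omega
    exact hk
  · intro h
    have := key 2 h
    omega

end


/-! ### Pairs of lists of defect at most two. -/

lemma Defect.symm {l m : List ℕ} {k : ℕ} (h : Defect l m k) : Defect m l k := by
  induction h with
  | nil => exact .nil
  | cons _ ih => exact .cons ih
  | double ha hb h _ => exact .swap (by omega) (.double ha hb h)
  | short ha hc hb h _ => exact .swap (by omega) (.short ha hc hb h)
  | long he hc ha hb h _ => exact .swap (by omega) (.long he hc ha hb h)
  | swap _ h _ => exact h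

lemma defect_cons_iff {a : ℕ} {l m : List ℕ} {k : ℕ} :
    Defect (a :: l) (a :: m) k ↔ Defect l m k := by
  refine ⟨fun h => ?_, .cons⟩
  cases h with
  | cons h => exact h
  | double => omega
  | short => omega
  | long => omega
  | swap => omega

/-- Every proper step removes a positive size, so only equal heads can be cancelled. -/
lemma defect_zero_iff {l m : List ℕ} : Defect l m 0 ↔ l = m := by
  constructor
  · intro h
    generalize hk : 0 = k at h
    induction h with
    | nil => rfl
    | cons _ ih => rw [ih hk]
    | double => omega
    | short => omega
    | long => omega
    | swap h _ ih =>
      have := ih hk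
      simp only [List.cons.injEq] at this
      omega
  · rintro rfl
    induction l with
    | nil => exact .nil
    | cons a l ih => exact .cons ih

/-- A single removal of size 1 must leave equal lists. `long` cannot do so, since it leaves unequal
heads c < a. -/
lemma defect_one_iff {a b : ℕ} {l m : List ℕ} (hab : a < b) :
    Defect (a :: l) (b :: m) 1 ↔
      a = 1 ∧ (b = 2 ∧ l = 1 :: m ∨ ∃ c, 0 < c ∧ b = c + 2 ∧ l = c :: 1 :: m) := by
  constructor
  · intro h
    generalize hk : 1 = k at h
    cases h with
    | cons => omega
    | @double _ _ _ _ k ha hb h =>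
      obtain ⟨rfl, rfl⟩ : a = 1 ∧ k = 0 := by omega
      exact ⟨rfl, Or.inl ⟨hb, defect_zero_iff.mp h⟩⟩
    | @short _ _ c _ _ k ha hc hb h =>
      obtain ⟨rfl, rfl⟩ : a = 1 ∧ k = 0 := by omega
      exact ⟨rfl, Or.inr ⟨c, hc, by omega, defect_zero_iff.mp h⟩⟩
    | @long _ _ c e _ _ k he hc ha hb h =>
      obtain ⟨rfl, rfl⟩ : e = 1 ∧ k = 0 := by omega
      have := defect_zero_iff.mp h
      simp only [List.cons.injEq] at this
      omega
    | swap => omega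
  · rintro ⟨rfl, ⟨rfl, rfl⟩ | ⟨c, hc, rfl, rfl⟩⟩
    · exact .double (k := 0) one_pos rfl (defect_zero_iff.mpr rfl)
    · exact .short (k := 0) one_pos hc (by omega) (defect_zero_iff.mpr rfl)

/-- There is either one removal of size 2 leaving equal lists, or a removal of size 1 leaving defect
one. -/
lemma defect_two_iff {a b : ℕ} {l m : List ℕ} (hab : a < b) :
    Defect (a :: l) (b :: m) 2 ↔
      a = 2 ∧ (b = 4 ∧ l = 2 :: m ∨ ∃ c, 0 < c ∧ b = c + 4 ∧ l = c :: 2 :: m) ∨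
      a = 2 ∧ b = 3 ∧ l = 1 :: m ∨
      a = 1 ∧ b = 2 ∧ Defect l (1 :: m) 1 ∨
      a = 1 ∧ ∃ c, 0 < c ∧ b = c + 2 ∧ Defect l (c :: 1 :: m) 1 := by
  constructor
  · intro h
    generalize hk : 2 = k at h
    cases h with
    | cons => omega
    | @double _ _ _ _ k ha hb h =>
      obtain ⟨rfl, rfl⟩ | ⟨rfl, rfl⟩ : a = 1 ∧ k = 1 ∨ a = 2 ∧ k = 0 := by omega
      · exact Or.inr (Or.inr (Or.inl ⟨rfl, hb, h⟩))
      · exact Or.inl ⟨rfl, Or.inl ⟨hb, defect_zero_iff.mp h⟩⟩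
    | @short _ _ c _ _ k ha hc hb h =>
      obtain ⟨rfl, rfl⟩ | ⟨rfl, rfl⟩ : a = 1 ∧ k = 1 ∨ a = 2 ∧ k = 0 := by omega
      · exact Or.inr (Or.inr (Or.inr ⟨rfl, c, hc, by omega, h⟩))
      · exact Or.inl ⟨rfl, Or.inr ⟨c, hc, by omega, defect_zero_iff.mp h⟩⟩
    | @long _ _ c e _ _ k he hc ha hb h =>
      obtain ⟨rfl, rfl⟩ | ⟨rfl, rfl⟩ : e = 1 ∧ k = 1 ∨ e = 2 ∧ k = 0 := by omega
      -- The remaining heads are c and c + 1, and defect one forces c = 1; this is the isolated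
      -- shape with heads 2 and 3.
      · rw [defect_one_iff (by omega)] at h
        obtain ⟨rfl, ⟨ha', hl⟩ | ⟨c', hc', ha', hl⟩⟩ := h
        · exact Or.inr (Or.inl ⟨ha, by omega, hl⟩)
        · omega
      · have := defect_zero_iff.mp h
        simp only [List.cons.injEq] at this
        omega
    | swap => omega
  · rintro (⟨rfl, ⟨rfl, rfl⟩ | ⟨c, hc, rfl, rfl⟩⟩ | ⟨rfl, rfl, rfl⟩ | ⟨rfl, rfl, h⟩ |
      ⟨rfl, c, hc, rfl, h⟩)
    · exact .double (k := 0) two_pos rfl (defect_zero_iff.mpr rfl)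
    · exact .short (k := 0) two_pos hc (by omega) (defect_zero_iff.mpr rfl)
    · exact .long (c := 1) (k := 1) one_pos one_pos rfl rfl
        ((defect_one_iff (by omega)).mpr ⟨rfl, Or.inl ⟨rfl, rfl⟩⟩)
    · exact .double (k := 1) one_pos rfl h
    · exact .short (k := 1) one_pos hc (by omega) h


/-! ### Counting pairs of compositions by comparing first parts. -/

/-- The compositions of `n`, as lists. -/
def comps (n : ℕ) : Finset (List ℕ) :=
  (Finset.univ : Finset (Composition n)).image Composition.blocks

lemma mem_comps {n : ℕ} {l : List ℕ} : l ∈ comps n ↔ (∀ x ∈ l, 0 < x) ∧ l.sum = n := by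
  simp only [comps, Finset.mem_image, Finset.mem_univ, true_and]
  constructor
  · rintro ⟨c, rfl⟩
    exact ⟨fun x hx => c.blocks_pos hx, c.blocks_sum⟩
  · rintro ⟨h1, h2⟩
    exact ⟨⟨l, fun {x} hx => h1 x hx, h2⟩, rfl⟩

lemma card_comps (n : ℕ) : (comps n).card = 2 ^ (n - 1) := by
  rw [comps, Finset.card_image_of_injective _ fun _ _ h => Composition.ext h, Finset.card_univ,
    composition_card]

lemma cons_mem_comps {n a : ℕ} {l : List ℕ} :
    a :: l ∈ comps n ↔ 0 < a ∧ (∀ x ∈ l, 0 < x) ∧ a + l.sum = n := by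
  simp only [mem_comps, List.mem_cons, forall_eq_or_imp, List.sum_cons, and_assoc]

lemma nil_mem_comps {n : ℕ} : [] ∈ comps n ↔ n = 0 := by
  simp [mem_comps, eq_comm]

/-- The nonempty compositions of `n`. -/
def neComps (n : ℕ) : Finset (List ℕ) := (comps n).erase []

lemma mem_neComps {n : ℕ} {l : List ℕ} : l ∈ neComps n ↔ l ≠ [] ∧ l ∈ comps n := Finset.mem_erase

lemma card_neComps_zero : (neComps 0).card = 0 := by
  rw [neComps, Finset.card_erase_of_mem (nil_mem_comps.mpr rfl), card_comps]
  rfl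

lemma card_neComps_succ (n : ℕ) : (neComps (n + 1)).card = 2 ^ n := by
  rw [neComps, Finset.erase_eq_of_notMem (by simp [nil_mem_comps]), card_comps, Nat.add_sub_cancel]

open Classical in
/-- The pairs of compositions of `n` of defect `k` satisfying `P`. -/
noncomputable def pairs (k n : ℕ) (P : List ℕ → List ℕ → Prop) : Finset (List ℕ × List ℕ) :=
  (comps n ×ˢ comps n).filter fun p => Defect p.1 p.2 k ∧ P p.1 p.2

lemma mem_pairs {k n : ℕ} {P : List ℕ → List ℕ → Prop} {l m : List ℕ} :
    (l, m) ∈ pairs k n P ↔ l ∈ comps n ∧ m ∈ comps n ∧ Defect l m k ∧ P l m := by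
  simp [pairs, and_assoc]

/-- The number of pairs of compositions of `n` of defect `k` satisfying `P`. -/
noncomputable def count (k n : ℕ) (P : List ℕ → List ℕ → Prop) : ℕ := (pairs k n P).card

lemma count_split {k n : ℕ} {P Q R : List ℕ → List ℕ → Prop}
    (h : ∀ l m, l ∈ comps n → m ∈ comps n → Defect l m k → (P l m ↔ Q l m ∨ R l m))
    (hd : ∀ l m, Q l m → R l m → False) : count k n P = count k n Q + count k n R := by
  classical
  have hdis : Disjoint (pairs k n Q) (pairs k n R) := by
    rw [Finset.disjoint_left]
    rintro ⟨l, m⟩ h1 h2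
    rw [mem_pairs] at h1 h2
    exact hd l m h1.2.2.2 h2.2.2.2
  rw [count, count, count, ← Finset.card_union_of_disjoint hdis]
  congr 1
  ext ⟨l, m⟩
  rw [Finset.mem_union, mem_pairs, mem_pairs, mem_pairs]
  constructor
  · rintro ⟨h1, h2, h3, h4⟩
    exact ((h l m h1 h2 h3).mp h4).imp (fun h5 => ⟨h1, h2, h3, h5⟩) fun h5 => ⟨h1, h2, h3, h5⟩
  · rintro (⟨h1, h2, h3, h4⟩ | ⟨h1, h2, h3, h4⟩)
    · exact ⟨h1, h2, h3, (h l m h1 h2 h3).mpr (Or.inl h4)⟩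
    · exact ⟨h1, h2, h3, (h l m h1 h2 h3).mpr (Or.inr h4)⟩

lemma count_congr {k n : ℕ} {P Q : List ℕ → List ℕ → Prop}
    (h : ∀ l m, l ∈ comps n → m ∈ comps n → Defect l m k → (P l m ↔ Q l m)) :
    count k n P = count k n Q := by
  rw [count_split (Q := Q) (R := fun _ _ => False) (by simpa using h) (fun _ _ _ h => h)]
  simp [count, pairs]

lemma count_swap {k n : ℕ} {P : List ℕ → List ℕ → Prop} :
    count k n P = count k n fun l m => P m l := by
  refine Finset.card_bij (fun p _ => p.swap) ?_ (fun _ _ _ _ h => Prod.swap_injective h) ?_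
  · rintro ⟨l, m⟩ h
    rw [mem_pairs] at h
    exact mem_pairs.mpr ⟨h.2.1, h.1, h.2.2.1.symm, h.2.2.2⟩
  · rintro ⟨l, m⟩ h
    rw [mem_pairs] at h
    exact ⟨(m, l), mem_pairs.mpr ⟨h.2.1, h.1, h.2.2.1.symm, h.2.2.2⟩, rfl⟩

lemma count_eq_card {α : Type*} {k n : ℕ} {P : List ℕ → List ℕ → Prop} {A : Finset α}
    (f : α → List ℕ × List ℕ) (hf : ∀ x ∈ A, f x ∈ pairs k n P)
    (hinj : ∀ x ∈ A, ∀ y ∈ A, f x = f y → x = y)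
    (hsurj : ∀ l m, l ∈ comps n → m ∈ comps n → Defect l m k → P l m → ∃ x ∈ A, f x = (l, m)) :
    count k n P = A.card := by
  refine (Finset.card_bij (fun x _ => f x) hf (fun x hx y hy => hinj x hx y hy) ?_).symm
  rintro ⟨l, m⟩ h
  rw [mem_pairs] at h
  obtain ⟨x, hx, hfx⟩ := hsurj l m h.1 h.2.1 h.2.2.1 h.2.2.2
  exact ⟨x, hx, hfx⟩

/-- The first parts agree. -/
def HeadEq (l m : List ℕ) : Prop := ∃ a l' m', l = a :: l' ∧ m = a :: m'

/-- The first part of the first list is smaller. -/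
def HeadLt (l m : List ℕ) : Prop := ∃ a b l' m', a < b ∧ l = a :: l' ∧ m = b :: m'

lemma headEq_cons {a b : ℕ} {l m : List ℕ} : HeadEq (a :: l) (b :: m) ↔ a = b := by
  constructor
  · rintro ⟨c, l', m', h1, h2⟩
    rw [List.cons.injEq] at h1 h2
    rw [h1.1, h2.1]
  · rintro rfl
    exact ⟨a, l, m, rfl, rfl⟩

lemma headLt_cons {a b : ℕ} {l m : List ℕ} : HeadLt (a :: l) (b :: m) ↔ a < b := by
  constructor
  · rintro ⟨c, d, l', m', hcd, h1, h2⟩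
    rw [List.cons.injEq] at h1 h2
    rwa [h1.1, h2.1]
  · intro h
    exact ⟨a, b, l, m, h, rfl, rfl⟩

lemma exists_cons_of_mem_comps {n : ℕ} (hn : 0 < n) {l : List ℕ} (hl : l ∈ comps n) :
    ∃ a l', l = a :: l' := by
  cases l with
  | nil => rw [nil_mem_comps] at hl; omega
  | cons a l' => exact ⟨a, l', rfl⟩

lemma count_trichotomy {k n : ℕ} (hn : 0 < n) (P : List ℕ → List ℕ → Prop) :
    count k n P = count k n (fun l m => HeadEq l m ∧ P l m) +
      (count k n (fun l m => HeadLt l m ∧ P l m) + count k n fun l m => HeadLt m l ∧ P l m) := by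
  rw [← count_split (P := fun l m => (HeadLt l m ∨ HeadLt m l) ∧ P l m)]
  · refine count_split (fun l m hl hm _ => ?_) ?_
    · obtain ⟨a, l, rfl⟩ := exists_cons_of_mem_comps hn hl
      obtain ⟨b, m, rfl⟩ := exists_cons_of_mem_comps hn hm
      rw [headEq_cons, headLt_cons, headLt_cons]
      constructor
      · intro h
        rcases lt_trichotomy a b with h1 | h1 | h1
        · exact Or.inr ⟨Or.inl h1, h⟩
        · exact Or.inl ⟨h1, h⟩
        · exact Or.inr ⟨Or.inr h1, h⟩
      · rintro (h | h) <;> exact h.2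
    · rintro _ _ ⟨⟨a, l, m, rfl, rfl⟩, -⟩ ⟨h | h, -⟩ <;> exact lt_irrefl _ (headLt_cons.mp h)
  · intro l m _ _ _
    tauto
  · rintro _ _ ⟨⟨a, b, l, m, hab, rfl, rfl⟩, -⟩ ⟨h, -⟩
    exact lt_asymm hab (headLt_cons.mp h)

lemma count_all {k n : ℕ} (hn : 0 < n) : count k n (fun _ _ => True) =
    count k n HeadEq + 2 * count k n HeadLt := by
  rw [count_trichotomy hn]
  simp only [and_true]
  rw [count_swap (P := fun l m => HeadLt m l)]
  change count k n HeadEq + (count k n HeadLt + count k n HeadLt) = _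
  ring

lemma count_zero (k : ℕ) (hk : 0 < k) (P : List ℕ → List ℕ → Prop) : count k 0 P = 0 := by
  rw [count, Finset.card_eq_zero, Finset.eq_empty_iff_forall_notMem]
  rintro ⟨l, m⟩ h
  rw [mem_pairs] at h
  obtain ⟨hl, hm, hD, -⟩ := h
  cases l with
  | cons a l => rw [cons_mem_comps] at hl; omega
  | nil =>
    cases m with
    | cons a m => rw [cons_mem_comps] at hm; omega
    | nil => cases hD; omega

/-- Increase the first part by one. -/
def bump : List ℕ → List ℕ
  | [] => []
  | a :: l => (a + 1) :: l

lemma bump_injective : Function.Injective bump := by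
  rintro (_ | ⟨a, l⟩) (_ | ⟨b, m⟩) h
  · rfl
  · exact absurd h (by simp [bump])
  · exact absurd h (by simp [bump])
  · simpa [bump] using h

/-- Pairs with the same first part: this part is `1`, or it can be decreased. -/
lemma count_headEq_succ {k n : ℕ} {P P' : List ℕ → List ℕ → Prop}
    (hP : ∀ a l m, P (a :: l) (a :: m) ↔ P' l m) :
    count k (n + 1) (fun l m => HeadEq l m ∧ P l m) =
      count k n P' + count k n fun l m => HeadEq l m ∧ P l m := by
  rw [count_split (Q := fun l m => (∃ l' m', l = 1 :: l' ∧ m = 1 :: m') ∧ P l m)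
    (R := fun l m => (∃ a l' m', 1 < a ∧ l = a :: l' ∧ m = a :: m') ∧ P l m)]
  · congr 1
    · refine count_eq_card (fun p => (1 :: p.1, 1 :: p.2)) ?_ ?_ ?_
      · rintro ⟨l, m⟩ h
        rw [mem_pairs] at h ⊢
        simp only [mem_comps] at h
        dsimp only at h ⊢
        rw [cons_mem_comps, cons_mem_comps, defect_cons_iff]
        exact ⟨⟨one_pos, h.1.1, by omega⟩, ⟨one_pos, h.2.1.1, by omega⟩, h.2.2.1,
          ⟨l, m, rfl, rfl⟩, (hP _ _ _).mpr h.2.2.2⟩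
      · rintro ⟨l, m⟩ _ ⟨l', m'⟩ _ h
        simpa using h
      · rintro _ _ hl hm hD ⟨⟨l, m, rfl, rfl⟩, hp⟩
        rw [cons_mem_comps] at hl hm
        refine ⟨(l, m), mem_pairs.mpr ⟨?_, ?_, defect_cons_iff.mp hD, (hP _ _ _).mp hp⟩, rfl⟩
        · exact mem_comps.mpr ⟨hl.2.1, by omega⟩
        · exact mem_comps.mpr ⟨hm.2.1, by omega⟩
    · refine count_eq_card (fun p => (bump p.1, bump p.2)) ?_ ?_ ?_
      · rintro ⟨l, m⟩ h
        rw [mem_pairs] at h ⊢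
        obtain ⟨hl, hm, hD, ⟨a, l, m, rfl, rfl⟩, hp⟩ := h
        rw [cons_mem_comps] at hl hm
        simp only [bump]
        rw [cons_mem_comps, cons_mem_comps, defect_cons_iff]
        exact ⟨⟨by omega, hl.2.1, by omega⟩, ⟨by omega, hm.2.1, by omega⟩,
          defect_cons_iff.mp hD, ⟨a + 1, l, m, by omega, rfl, rfl⟩,
          (hP _ _ _).mpr ((hP _ _ _).mp hp)⟩
      · rintro ⟨l, m⟩ _ ⟨l', m'⟩ _ h
        rw [Prod.mk.injEq] at h ⊢
        exact ⟨bump_injective h.1, bump_injective h.2⟩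
      · rintro _ _ hl hm hD ⟨⟨a, l, m, ha, rfl, rfl⟩, hp⟩
        obtain ⟨a, rfl⟩ : ∃ b, a = b + 1 := ⟨a - 1, by omega⟩
        rw [cons_mem_comps] at hl hm
        refine ⟨(a :: l, a :: m), mem_pairs.mpr ⟨?_, ?_, ?_, ⟨a, l, m, rfl, rfl⟩,
          (hP _ _ _).mpr ((hP _ _ _).mp hp)⟩, rfl⟩
        · exact cons_mem_comps.mpr ⟨by omega, hl.2.1, by omega⟩
        · exact cons_mem_comps.mpr ⟨by omega, hm.2.1, by omega⟩
        · exact defect_cons_iff.mpr (defect_cons_iff.mp hD)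
  · intro l m hl hm _
    constructor
    · rintro ⟨⟨a, l, m, rfl, rfl⟩, hp⟩
      rw [cons_mem_comps] at hl
      by_cases ha : a = 1
      · subst ha
        exact Or.inl ⟨⟨l, m, rfl, rfl⟩, hp⟩
      · exact Or.inr ⟨⟨a, l, m, by omega, rfl, rfl⟩, hp⟩
    · rintro (⟨⟨l, m, rfl, rfl⟩, hp⟩ | ⟨⟨a, l, m, _, rfl, rfl⟩, hp⟩)
      · exact ⟨⟨1, l, m, rfl, rfl⟩, hp⟩
      · exact ⟨⟨a, l, m, rfl, rfl⟩, hp⟩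
  · rintro _ _ ⟨⟨l, m, rfl, rfl⟩, _⟩ ⟨⟨a, l', m', ha, h, _⟩, _⟩
    rw [List.cons.injEq] at h
    omega


/-! ### Counts of defect-one pairs. -/

/-- Prepend a part which may be zero. -/
def optCons (c : ℕ) (l : List ℕ) : List ℕ := if c = 0 then l else c :: l

@[simp] lemma optCons_zero (l : List ℕ) : optCons 0 l = l := rfl

@[simp] lemma optCons_succ (c : ℕ) (l : List ℕ) : optCons (c + 1) l = (c + 1) :: l := rfl

lemma optCons_mem_comps {n c : ℕ} {l : List ℕ} :
    optCons c l ∈ comps n ↔ (∀ x ∈ l, 0 < x) ∧ c + l.sum = n := by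
  cases c with
  | zero => rw [optCons_zero, mem_comps, zero_add]
  | succ c => rw [optCons_succ, cons_mem_comps]; simp

/-- An optional part of size b - 2 merges the `double` and `short` cases. -/
lemma defect_one_iff_optCons {a b : ℕ} {l m : List ℕ} (hab : a < b) :
    Defect (a :: l) (b :: m) 1 ↔ a = 1 ∧ l = optCons (b - 2) (1 :: m) := by
  rw [defect_one_iff hab]
  refine and_congr_right fun ha => ?_
  obtain ⟨c, rfl⟩ : ∃ c, b = c + 2 := ⟨b - 2, by omega⟩
  rw [Nat.add_sub_cancel]
  cases c with
  | zero =>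
    rw [optCons_zero]
    constructor
    · rintro (⟨_, h⟩ | ⟨c, hc, h, _⟩)
      · exact h
      · omega
    · exact fun h => Or.inl ⟨rfl, h⟩
  | succ c =>
    rw [optCons_succ]
    constructor
    · rintro (⟨h, _⟩ | ⟨d, hd, h, h'⟩)
      · omega
      · obtain rfl : c + 1 = d := by omega
        exact h'
    · exact fun h => Or.inr ⟨c + 1, by omega, rfl, h⟩

lemma count_eq_zero {k n : ℕ} {P : List ℕ → List ℕ → Prop}
    (h : ∀ l m, l ∈ comps n → m ∈ comps n → Defect l m k → ¬ P l m) : count k n P = 0 := by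
  rw [count, Finset.card_eq_zero, Finset.eq_empty_iff_forall_notMem]
  rintro ⟨l, m⟩ h'
  rw [mem_pairs] at h'
  exact h l m h'.1 h'.2.1 h'.2.2.1 h'.2.2.2

/-- The first part of the second list is `1`. -/
def HeadOne (_ m : List ℕ) : Prop := ∃ m', m = 1 :: m'

/-- The second part of the second list is `1`. -/
def SecondOne (_ m : List ℕ) : Prop := ∃ c m', m = c :: 1 :: m'

/-- The second list determines the first. Its head is at least 2, and lowering it by 1 leaves an
arbitrary nonempty composition of n. -/
lemma count_one_headLt (n : ℕ) : count 1 (n + 1) HeadLt = (neComps n).card := by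
  refine count_eq_card (fun x => (1 :: optCons (x.headI - 1) (1 :: x.tail),
    (x.headI + 1) :: x.tail)) ?_ ?_ ?_
  · rintro (_ | ⟨a, m⟩) h
    · exact absurd rfl (mem_neComps.mp h).1
    · have h := (mem_neComps.mp h).2
      rw [cons_mem_comps] at h
      dsimp only [List.headI, List.tail]
      rw [mem_pairs, cons_mem_comps, cons_mem_comps, headLt_cons,
        defect_one_iff_optCons (by omega), Nat.add_sub_add_right a 1 1]
      have := optCons_mem_comps (c := a - 1) (l := 1 :: m) (n := n) |>.mpr
        ⟨by simpa using h.2.1, by simp only [List.sum_cons]; omega⟩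
      rw [mem_comps] at this
      exact ⟨⟨one_pos, this.1, by omega⟩, ⟨by omega, h.2.1, by omega⟩, ⟨rfl, rfl⟩, by omega⟩
  · rintro (_ | ⟨a, m⟩) h (_ | ⟨b, m'⟩) h' heq
    · rfl
    · exact absurd rfl (mem_neComps.mp h).1
    · exact absurd rfl (mem_neComps.mp h').1
    · have := congrArg Prod.snd heq
      simpa using this
  · rintro _ _ hl hm hD ⟨a, b, l, m, hab, rfl, rfl⟩
    rw [defect_one_iff_optCons hab] at hD
    obtain ⟨rfl, rfl⟩ := hD
    rw [cons_mem_comps] at hm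
    refine ⟨(b - 1) :: m, mem_neComps.mpr ⟨by simp, cons_mem_comps.mpr
      ⟨by omega, hm.2.1, by omega⟩⟩, ?_⟩
    dsimp only [List.headI, List.tail]
    rw [Nat.sub_sub, Nat.sub_add_cancel (by omega)]

/-- If the heads differ, defect one forces the smaller head to be 1, so the condition is automatic
when the second head is smaller and impossible when it is larger. -/
lemma count_one_headOne (n : ℕ) : count 1 (n + 1) HeadOne =
    count 1 n (fun _ _ => True) + count 1 (n + 1) HeadLt := by
  rw [count_trichotomy (Nat.succ_pos n)]
  congr 1
  · refine count_eq_card (fun p => (1 :: p.1, 1 :: p.2)) ?_ ?_ ?_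
    · rintro ⟨l, m⟩ h
      rw [mem_pairs] at h ⊢
      simp only [mem_comps] at h
      dsimp only at h ⊢
      rw [cons_mem_comps, cons_mem_comps, defect_cons_iff, headEq_cons]
      exact ⟨⟨one_pos, h.1.1, by omega⟩, ⟨one_pos, h.2.1.1, by omega⟩, h.2.2.1, rfl, ⟨m, rfl⟩⟩
    · rintro ⟨l, m⟩ _ ⟨l', m'⟩ _ h
      simpa using h
    · rintro _ _ hl hm hD ⟨⟨a, l, m, rfl, rfl⟩, m', hm'⟩
      obtain ⟨rfl, rfl⟩ := List.cons.inj hm'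
      rw [cons_mem_comps] at hl hm
      refine ⟨(l, m), mem_pairs.mpr ⟨?_, ?_, defect_cons_iff.mp hD, trivial⟩, rfl⟩
      · exact mem_comps.mpr ⟨hl.2.1, by omega⟩
      · exact mem_comps.mpr ⟨hm.2.1, by omega⟩
  · rw [count_eq_zero (P := fun l m => HeadLt l m ∧ HeadOne l m), zero_add, count_swap]
    · refine count_congr fun l m hl hm hD => and_iff_left_of_imp ?_
      rintro ⟨a, b, l, m, hab, rfl, rfl⟩
      rw [defect_one_iff_optCons hab] at hD
      exact ⟨l, by rw [hD.1]⟩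
    · rintro _ _ hl hm _ ⟨⟨a, b, l, m, hab, rfl, rfl⟩, m', hm'⟩
      rw [cons_mem_comps] at hl
      have := (List.cons.inj hm').1
      omega

/-- As for `count_one_headLt`, with the prescribed second part 1 deleted as well. -/
lemma count_headLt_secondOne (n : ℕ) :
    count 1 (n + 2) (fun l m => HeadLt l m ∧ SecondOne l m) = (neComps n).card := by
  refine count_eq_card (fun x => (1 :: optCons (x.headI - 1) (1 :: 1 :: x.tail),
    (x.headI + 1) :: 1 :: x.tail)) ?_ ?_ ?_
  · rintro (_ | ⟨a, m⟩) h
    · exact absurd rfl (mem_neComps.mp h).1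
    · have h := (mem_neComps.mp h).2
      rw [cons_mem_comps] at h
      dsimp only [List.headI, List.tail]
      rw [mem_pairs, cons_mem_comps, cons_mem_comps, headLt_cons,
        defect_one_iff_optCons (by omega), Nat.add_sub_add_right a 1 1]
      have := optCons_mem_comps (c := a - 1) (l := 1 :: 1 :: m) (n := n + 1) |>.mpr
        ⟨by simpa using h.2.1, by simp only [List.sum_cons]; omega⟩
      rw [mem_comps] at this
      exact ⟨⟨one_pos, this.1, by omega⟩, ⟨by omega, by simpa using h.2.1,
        by simp only [List.sum_cons]; omega⟩, ⟨rfl, rfl⟩, by omega, ⟨_, _, rfl⟩⟩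
  · rintro (_ | ⟨a, m⟩) h (_ | ⟨b, m'⟩) h' heq
    · rfl
    · exact absurd rfl (mem_neComps.mp h).1
    · exact absurd rfl (mem_neComps.mp h').1
    · have := congrArg Prod.snd heq
      simpa using this
  · rintro _ _ hl hm hD ⟨⟨a, b, l, m, hab, rfl, rfl⟩, c, m', hm'⟩
    rw [defect_one_iff_optCons hab] at hD
    obtain ⟨rfl, rfl⟩ := hD
    obtain ⟨rfl, rfl⟩ := List.cons.inj hm'
    simp only [cons_mem_comps, List.mem_cons, forall_eq_or_imp, List.sum_cons] at hm
    refine ⟨(b - 1) :: m', mem_neComps.mpr ⟨by simp, cons_mem_comps.mpr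
      ⟨by omega, hm.2.1.2, by omega⟩⟩, ?_⟩
    dsimp only [List.headI, List.tail]
    rw [Nat.sub_sub, Nat.sub_add_cancel (by omega)]

/-- Both lists start with prescribed parts. -/
def Heads (a b : ℕ) (l m : List ℕ) : Prop := ∃ l' m', l = a :: l' ∧ m = b :: m'

/-- The list with the smaller head is 1 followed by `optCons (b - 2) (1 :: m)`, whose first entry is
1 exactly for b = 2 and b = 3. -/
lemma count_headGt_secondOne (n : ℕ) :
    count 1 n (fun l m => HeadLt m l ∧ SecondOne l m) =
      count 1 n (Heads 1 2) + count 1 n (Heads 1 3) := by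
  rw [count_swap]
  refine count_split ?_ ?_
  · intro l m hl hm hD
    constructor
    · rintro ⟨⟨a, b, l, m, hab, rfl, rfl⟩, c, m', hm'⟩
      rw [defect_one_iff_optCons hab] at hD
      obtain ⟨rfl, rfl⟩ := hD
      rw [List.cons.injEq] at hm'
      obtain ⟨c, rfl⟩ : ∃ c, b = c + 2 := ⟨b - 2, by omega⟩
      rw [Nat.add_sub_cancel] at hm'
      cases c with
      | zero => exact Or.inl ⟨_, _, rfl, rfl⟩
      | succ c =>
        rw [optCons_succ, List.cons.injEq] at hm'
        obtain rfl : c = 0 := by omega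
        exact Or.inr ⟨_, _, rfl, rfl⟩
    · rintro (⟨l, m, rfl, rfl⟩ | ⟨l, m, rfl, rfl⟩)
      · rw [defect_one_iff_optCons (by omega)] at hD
        exact ⟨headLt_cons.mpr (by omega), 1, m, by rw [hD.2]; rfl⟩
      · rw [defect_one_iff_optCons (by omega)] at hD
        exact ⟨headLt_cons.mpr (by omega), 1, 1 :: m, by rw [hD.2]; rfl⟩
  · rintro _ _ ⟨l, m, rfl, rfl⟩ ⟨l', m', _, h⟩
    have := (List.cons.inj h).1
    omega

lemma count_heads_one_two (n : ℕ) : count 1 (n + 2) (Heads 1 2) = (comps n).card := by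
  refine count_eq_card (fun m => (1 :: 1 :: m, 2 :: m)) ?_ ?_ ?_
  · intro m hm
    rw [mem_comps] at hm
    rw [mem_pairs, cons_mem_comps, cons_mem_comps, defect_one_iff_optCons (by omega)]
    refine ⟨⟨one_pos, by simpa using hm.1, by simp only [List.sum_cons]; omega⟩,
      ⟨two_pos, hm.1, by omega⟩, ⟨rfl, rfl⟩, ⟨_, _, rfl, rfl⟩⟩
  · intro m _ m' _ h
    simpa using h
  · rintro _ _ hl hm hD ⟨l, m, rfl, rfl⟩
    rw [defect_one_iff_optCons (by omega)] at hD
    obtain ⟨-, rfl⟩ := hD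
    rw [cons_mem_comps] at hm
    exact ⟨m, mem_comps.mpr ⟨hm.2.1, by omega⟩, rfl⟩

lemma count_heads_one_three (n : ℕ) : count 1 (n + 3) (Heads 1 3) = (comps n).card := by
  refine count_eq_card (fun m => (1 :: 1 :: 1 :: m, 3 :: m)) ?_ ?_ ?_
  · intro m hm
    rw [mem_comps] at hm
    rw [mem_pairs, cons_mem_comps, cons_mem_comps, defect_one_iff_optCons (by omega)]
    refine ⟨⟨one_pos, by simpa using hm.1, by simp only [List.sum_cons]; omega⟩,
      ⟨three_pos, hm.1, by omega⟩, ⟨rfl, rfl⟩, ⟨_, _, rfl, rfl⟩⟩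
  · intro m _ m' _ h
    simpa using h
  · rintro _ _ hl hm hD ⟨l, m, rfl, rfl⟩
    rw [defect_one_iff_optCons (by omega)] at hD
    obtain ⟨-, rfl⟩ := hD
    rw [cons_mem_comps] at hm
    exact ⟨m, mem_comps.mpr ⟨hm.2.1, by omega⟩, rfl⟩


/-! ### Defect-two pairs with unequal first parts. -/

lemma defect_two_iff_optCons {a b : ℕ} {l m : List ℕ} (hab : a < b) :
    Defect (a :: l) (b :: m) 2 ↔
      a = 2 ∧ 4 ≤ b ∧ l = optCons (b - 4) (2 :: m) ∨
      a = 2 ∧ b = 3 ∧ l = 1 :: m ∨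
      a = 1 ∧ b = 2 ∧ Defect l (1 :: m) 1 ∨
      a = 1 ∧ ∃ c, 0 < c ∧ b = c + 2 ∧ Defect l (c :: 1 :: m) 1 := by
  rw [defect_two_iff hab]
  refine or_congr_left (and_congr_right fun ha => ?_)
  constructor
  · rintro (⟨rfl, rfl⟩ | ⟨c, hc, rfl, rfl⟩)
    · exact ⟨le_rfl, rfl⟩
    · obtain ⟨c, rfl⟩ : ∃ d, c = d + 1 := ⟨c - 1, by omega⟩
      exact ⟨by omega, by rw [Nat.add_sub_cancel]; rfl⟩
  · rintro ⟨hb, rfl⟩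
    obtain ⟨c, rfl⟩ : ∃ c, b = c + 4 := ⟨b - 4, by omega⟩
    rw [Nat.add_sub_cancel]
    cases c with
    | zero => exact Or.inl ⟨rfl, rfl⟩
    | succ c => exact Or.inr ⟨c + 1, by omega, rfl, rfl⟩

/-- The first parts are `2` and a number which is at least `4`. -/
def HeadsTwoFour (l m : List ℕ) : Prop := ∃ b l' m', 4 ≤ b ∧ l = 2 :: l' ∧ m = b :: m'

/-- The first parts are `1` and a number which is at least `3`. -/
def HeadsOneThree (l m : List ℕ) : Prop := ∃ b l' m', 3 ≤ b ∧ l = 1 :: l' ∧ m = b :: m'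

lemma count_two_headLt_split (n : ℕ) : count 2 n HeadLt =
    count 2 n HeadsTwoFour + (count 2 n (Heads 2 3) +
      (count 2 n (Heads 1 2) + count 2 n HeadsOneThree)) := by
  rw [← count_split (P := fun l m => Heads 1 2 l m ∨ HeadsOneThree l m) (Q := Heads 1 2),
    ← count_split (P := fun l m => Heads 2 3 l m ∨ Heads 1 2 l m ∨ HeadsOneThree l m)]
  · refine count_split ?_ ?_
    · intro l m _ _ hD
      constructor
      · rintro ⟨a, b, l, m, hab, rfl, rfl⟩
        rw [defect_two_iff_optCons hab] at hD
        rcases hD with ⟨rfl, h, _⟩ | ⟨rfl, rfl, _⟩ | ⟨rfl, rfl, _⟩ | ⟨rfl, c, hc, rfl, _⟩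
        · exact Or.inl ⟨b, l, m, h, rfl, rfl⟩
        · exact Or.inr (Or.inl ⟨l, m, rfl, rfl⟩)
        · exact Or.inr (Or.inr (Or.inl ⟨l, m, rfl, rfl⟩))
        · exact Or.inr (Or.inr (Or.inr ⟨_, l, m, by omega, rfl, rfl⟩))
      · rintro (⟨b, l, m, hb, rfl, rfl⟩ | ⟨l, m, rfl, rfl⟩ | ⟨l, m, rfl, rfl⟩ |
          ⟨b, l, m, hb, rfl, rfl⟩) <;> exact headLt_cons.mpr (by omega)
    · rintro _ _ ⟨b, l, m, hb, rfl, rfl⟩ (⟨l, m, h1, h2⟩ | ⟨l, m, h1, h2⟩ |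
          ⟨b, l, m, hb, h1, h2⟩) <;> simp only [List.cons.injEq] at h1 h2 <;> omega
  · exact fun _ _ _ _ _ => Iff.rfl
  · rintro _ _ ⟨l, m, rfl, rfl⟩ (⟨l, m, h1, h2⟩ | ⟨b, l, m, hb, h1, h2⟩) <;>
      simp only [List.cons.injEq] at h1 h2 <;> omega
  · exact fun _ _ _ _ _ => Iff.rfl
  · rintro _ _ ⟨l, m, rfl, rfl⟩ ⟨b, l, m, hb, h1, h2⟩
    simp only [List.cons.injEq] at h1 h2
    omega

/-- Again the second list determines the first; its head is at least 4 and is lowered by 3. -/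
lemma count_headsTwoFour (n : ℕ) : count 2 (n + 3) HeadsTwoFour = (neComps n).card := by
  refine count_eq_card (fun x => (2 :: optCons (x.headI - 1) (2 :: x.tail),
    (x.headI + 3) :: x.tail)) ?_ ?_ ?_
  · rintro (_ | ⟨a, m⟩) h
    · exact absurd rfl (mem_neComps.mp h).1
    · have h := (mem_neComps.mp h).2
      rw [cons_mem_comps] at h
      dsimp only [List.headI, List.tail]
      rw [mem_pairs, cons_mem_comps, cons_mem_comps, defect_two_iff_optCons (by omega)]
      have := optCons_mem_comps (c := a - 1) (l := 2 :: m) (n := n + 1) |>.mpr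
        ⟨by simpa using h.2.1, by simp only [List.sum_cons]; omega⟩
      rw [mem_comps] at this
      exact ⟨⟨two_pos, this.1, by omega⟩, ⟨by omega, h.2.1, by omega⟩,
        Or.inl ⟨rfl, by omega, by rw [show a + 3 - 4 = a - 1 by omega]⟩,
        ⟨_, _, _, by omega, rfl, rfl⟩⟩
  · rintro (_ | ⟨a, m⟩) h (_ | ⟨b, m'⟩) h' heq
    · rfl
    · exact absurd rfl (mem_neComps.mp h).1
    · exact absurd rfl (mem_neComps.mp h').1
    · have := congrArg Prod.snd heq
      simpa using this
  · rintro _ _ hl hm hD ⟨b, l, m, hb, rfl, rfl⟩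
    rw [defect_two_iff_optCons (by omega)] at hD
    rcases hD with ⟨-, -, rfl⟩ | ⟨-, h, -⟩ | ⟨h, -⟩ | ⟨h, -⟩
    · rw [cons_mem_comps] at hm
      refine ⟨(b - 3) :: m, mem_neComps.mpr ⟨by simp, cons_mem_comps.mpr
        ⟨by omega, hm.2.1, by omega⟩⟩, ?_⟩
      dsimp only [List.headI, List.tail]
      rw [Nat.sub_sub, Nat.sub_add_cancel (by omega)]
    · omega
    · omega
    · omega

lemma count_heads_two_three (n : ℕ) : count 2 (n + 3) (Heads 2 3) = (comps n).card := by
  refine count_eq_card (fun m => (2 :: 1 :: m, 3 :: m)) ?_ ?_ ?_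
  · intro m hm
    rw [mem_comps] at hm
    rw [mem_pairs, cons_mem_comps, cons_mem_comps, defect_two_iff_optCons (by omega)]
    exact ⟨⟨two_pos, by simpa using hm.1, by simp only [List.sum_cons]; omega⟩,
      ⟨three_pos, hm.1, by omega⟩, Or.inr (Or.inl ⟨rfl, rfl, rfl⟩), ⟨_, _, rfl, rfl⟩⟩
  · intro m _ m' _ h
    simpa using h
  · rintro _ _ hl hm hD ⟨l, m, rfl, rfl⟩
    rw [defect_two_iff_optCons (by omega)] at hD
    rcases hD with ⟨-, h, -⟩ | ⟨-, -, rfl⟩ | ⟨h, -⟩ | ⟨h, -⟩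
    · omega
    · rw [cons_mem_comps] at hm
      exact ⟨m, mem_comps.mpr ⟨hm.2.1, by omega⟩, rfl⟩
    · omega
    · omega

/-- Replacing a leading 1 of the second list by 2, and prepending 1 to the first, inverts the
`double` step. -/
lemma count_two_heads_one_two (n : ℕ) :
    count 2 (n + 1) (Heads 1 2) = count 1 n HeadOne := by
  refine count_eq_card (fun p => (1 :: p.1, bump p.2)) ?_ ?_ ?_
  · rintro ⟨l, m⟩ h
    obtain ⟨hl, hm, hD, m, rfl⟩ := mem_pairs.mp h
    rw [mem_comps] at hl
    rw [cons_mem_comps] at hm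
    dsimp only [bump]
    rw [mem_pairs, cons_mem_comps, cons_mem_comps, defect_two_iff_optCons (by omega)]
    exact ⟨⟨one_pos, hl.1, by omega⟩, ⟨by omega, hm.2.1, by omega⟩,
      Or.inr (Or.inr (Or.inl ⟨rfl, rfl, hD⟩)), ⟨_, _, rfl, rfl⟩⟩
  · rintro ⟨l, m⟩ _ ⟨l', m'⟩ _ h
    rw [Prod.mk.injEq, List.cons.injEq] at h
    rw [Prod.mk.injEq]
    exact ⟨h.1.2, bump_injective h.2⟩
  · rintro _ _ hl hm hD ⟨l, m, rfl, rfl⟩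
    rw [cons_mem_comps] at hl hm
    rw [defect_two_iff_optCons (by omega)] at hD
    rcases hD with ⟨h, -⟩ | ⟨h, -⟩ | ⟨-, -, hD⟩ | ⟨-, c, hc, h, -⟩
    · omega
    · omega
    · exact ⟨(l, 1 :: m), mem_pairs.mpr ⟨mem_comps.mpr ⟨hl.2.1, by omega⟩,
        cons_mem_comps.mpr ⟨one_pos, hm.2.1, by omega⟩, hD, ⟨m, rfl⟩⟩, rfl⟩
    · omega

/-- Merging leading parts c, 1 of the second list into c + 2, and prepending 1 to the first, inverts
the `short` step. -/
lemma count_headsOneThree (n : ℕ) :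
    count 2 (n + 1) HeadsOneThree = count 1 n SecondOne := by
  refine count_eq_card (fun p => (1 :: p.1, (p.2.headI + 2) :: p.2.tail.tail)) ?_ ?_ ?_
  · rintro ⟨l, m⟩ h
    obtain ⟨hl, hm, hD, c, m, rfl⟩ := mem_pairs.mp h
    rw [mem_comps] at hl
    simp only [cons_mem_comps, List.mem_cons, forall_eq_or_imp, List.sum_cons] at hm
    dsimp only [List.headI, List.tail]
    rw [mem_pairs, cons_mem_comps, cons_mem_comps, defect_two_iff_optCons (by omega)]
    exact ⟨⟨one_pos, hl.1, by omega⟩, ⟨by omega, hm.2.1.2, by omega⟩,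
      Or.inr (Or.inr (Or.inr ⟨rfl, c, hm.1, rfl, hD⟩)), ⟨_, _, _, by omega, rfl, rfl⟩⟩
  · rintro ⟨l, m⟩ h ⟨l', m'⟩ h' heq
    obtain ⟨-, -, -, c, m, rfl⟩ := mem_pairs.mp h
    obtain ⟨-, -, -, c', m', rfl⟩ := mem_pairs.mp h'
    simpa using heq
  · rintro _ _ hl hm hD ⟨b, l, m, hb, rfl, rfl⟩
    rw [cons_mem_comps] at hl hm
    rw [defect_two_iff_optCons (by omega)] at hD
    rcases hD with ⟨h, -⟩ | ⟨h, -⟩ | ⟨-, h, -⟩ | ⟨-, c, hc, rfl, hD⟩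
    · omega
    · omega
    · omega
    · exact ⟨(l, c :: 1 :: m), mem_pairs.mpr ⟨mem_comps.mpr ⟨hl.2.1, by omega⟩,
        cons_mem_comps.mpr ⟨hc, by simpa using hm.2.1, by simp only [List.sum_cons]; omega⟩, hD,
        ⟨c, m, rfl⟩⟩, rfl⟩

/-! ### Recurrences, small values and closed forms. -/

lemma count_headEq_succ' (k n : ℕ) :
    count k (n + 1) HeadEq = count k n (fun _ _ => True) + count k n HeadEq := by
  simpa using count_headEq_succ (k := k) (n := n) (P := fun _ _ => True) (P' := fun _ _ => True)
    (fun _ _ _ => Iff.rfl)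

lemma count_headEq_secondOne_succ (n : ℕ) :
    count 1 (n + 1) (fun l m => HeadEq l m ∧ SecondOne l m) =
      count 1 n HeadOne + count 1 n fun l m => HeadEq l m ∧ SecondOne l m := by
  refine count_headEq_succ fun a l m => ?_
  constructor
  · rintro ⟨c, m', h⟩
    exact ⟨m', (List.cons.inj h).2⟩
  · rintro ⟨m', rfl⟩
    exact ⟨a, m', rfl⟩

lemma count_headEq_one {k : ℕ} (hk : 0 < k) : count k 1 HeadEq = 0 := by
  have h := count_headEq_succ' k 0
  rwa [count_zero k hk, count_zero k hk] at h

lemma count_one_all_one : count 1 1 (fun _ _ => True) = 0 := by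
  have h : count 1 1 HeadLt = _ := count_one_headLt 0
  rw [count_all one_pos, count_headEq_one one_pos]
  rw [card_neComps_zero] at h
  omega

lemma count_one_headEq (n : ℕ) : count 1 (n + 2) HeadEq = n * 2 ^ n := by
  induction n with
  | zero =>
    rw [count_headEq_succ', count_one_all_one, count_headEq_one one_pos]
    simp
  | succ n ih =>
    rw [count_headEq_succ', count_all (by omega), ih, count_one_headLt, card_neComps_succ]
    ring

lemma count_one_all (n : ℕ) : count 1 (n + 2) (fun _ _ => True) = (n + 2) * 2 ^ n := by
  rw [count_all (by omega), count_one_headEq, count_one_headLt, card_neComps_succ]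
  ring

lemma count_headOne_one : count 1 1 HeadOne = 0 := by
  rw [count_one_headOne, count_one_headLt, card_neComps_zero, count_zero 1 one_pos]

lemma count_headOne_two : count 1 2 HeadOne = 1 := by
  rw [count_one_headOne, count_one_headLt, card_neComps_succ, count_one_all_one]
  rfl

lemma count_headOne (n : ℕ) : count 1 (n + 3) HeadOne = (n + 4) * 2 ^ n := by
  rw [count_one_headOne, count_one_all, count_one_headLt, card_neComps_succ]
  ring

lemma count_headEq_secondOne_two :
    count 1 2 (fun l m => HeadEq l m ∧ SecondOne l m) = 0 := by
  rw [count_headEq_secondOne_succ, count_headEq_secondOne_succ, count_headOne_one]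
  simp only [count_zero 1 one_pos]

/-- The + 1 avoids truncated subtraction. -/
lemma count_headEq_secondOne (n : ℕ) :
    count 1 (n + 3) (fun l m => HeadEq l m ∧ SecondOne l m) + 1 = (n + 2) * 2 ^ n := by
  induction n with
  | zero =>
    rw [count_headEq_secondOne_succ, count_headEq_secondOne_two, count_headOne_two]
    norm_num
  | succ n ih =>
    rw [count_headEq_secondOne_succ, add_assoc, ih, count_headOne]
    ring

lemma count_secondOne_two : count 1 2 SecondOne = 1 := by
  have h1 := count_headLt_secondOne 0
  have h2 := count_heads_one_two 0
  rw [zero_add] at h1 h2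
  rw [count_trichotomy two_pos, count_headEq_secondOne_two, h1,
    card_neComps_zero, count_headGt_secondOne, h2, card_comps, count_eq_zero (P := Heads 1 3)]
  · norm_num
  · rintro _ _ _ hm _ ⟨l, m, rfl, rfl⟩
    rw [cons_mem_comps] at hm
    omega

/-- The last power counts the compositions of n; for n = 0 truncation makes it 1, the empty
composition, which is correct but breaks the uniform formula. -/
lemma count_secondOne (n : ℕ) : count 1 (n + 3) SecondOne =
    count 1 (n + 3) (fun l m => HeadEq l m ∧ SecondOne l m) + 2 ^ n + 2 ^ n + 2 ^ (n - 1) := by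
  rw [count_trichotomy (by omega), count_headLt_secondOne, card_neComps_succ,
    count_headGt_secondOne, count_heads_one_two, count_heads_one_three, card_comps, card_comps,
    Nat.add_sub_cancel]
  ring

lemma count_two_headLt (n : ℕ) : count 2 (n + 3) HeadLt =
    (neComps n).card + (2 ^ (n - 1) + (count 1 (n + 2) HeadOne + count 1 (n + 2) SecondOne)) := by
  rw [count_two_headLt_split, count_headsTwoFour, count_heads_two_three, card_comps,
    count_two_heads_one_two, count_headsOneThree]

lemma count_two_headLt_three : count 2 3 HeadLt = 3 := by
  rw [count_two_headLt, card_neComps_zero, count_headOne_two, count_secondOne_two]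
  norm_num

lemma count_two_headLt_four : count 2 4 HeadLt = 10 := by
  have h := count_headEq_secondOne 0
  rw [count_two_headLt, card_neComps_succ, count_headOne, count_secondOne]
  norm_num at h ⊢
  omega

/-- From total 5 on no exponent is truncated any more. -/
lemma count_two_headLt_add_five (n : ℕ) :
    count 2 (n + 5) HeadLt + 1 = (4 * n + 25) * 2 ^ n := by
  have h := count_headEq_secondOne (n + 1)
  rw [count_two_headLt, card_neComps_succ, count_headOne, count_secondOne]
  simp only [add_assoc, Nat.reduceAdd, pow_succ, Nat.add_one_sub_one] at h ⊢
  linarith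

lemma count_two_headEq_three : count 2 3 HeadEq = 0 := by
  have h : ∀ m, m < 3 → 0 < m → count 2 m HeadLt = 0 := by
    intro m hm hm0
    rw [count_two_headLt_split]
    have h2 : count 2 m (Heads 1 2) = 0 := by
      rcases m with _ | _ | _ | m
      · omega
      · exact (count_two_heads_one_two 0).trans (count_zero 1 one_pos _)
      · exact (count_two_heads_one_two 1).trans count_headOne_one
      · omega
    rw [h2, count_eq_zero (P := HeadsTwoFour), count_eq_zero (P := Heads 2 3),
      count_eq_zero (P := HeadsOneThree)]
    · rintro _ _ _ hm' _ ⟨b, l, m, hb, rfl, rfl⟩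
      rw [cons_mem_comps] at hm'
      omega
    · rintro _ _ _ hm' _ ⟨l, m, rfl, rfl⟩
      rw [cons_mem_comps] at hm'
      omega
    · rintro _ _ _ hm' _ ⟨b, l, m, hb, rfl, rfl⟩
      rw [cons_mem_comps] at hm'
      omega
  have h1 := count_headEq_one two_pos
  have h2 : count 2 2 HeadEq = _ := count_headEq_succ' 2 1
  have h3 : count 2 3 HeadEq = _ := count_headEq_succ' 2 2
  rw [count_all one_pos, h 1 (by omega) (by omega), h1] at h2
  rw [count_all two_pos, h 2 (by omega) (by omega)] at h3
  omega

lemma count_two_all_three : count 2 3 (fun _ _ => True) = 6 := by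
  rw [count_all three_pos, count_two_headEq_three, count_two_headLt_three]

lemma count_two_headEq_four : count 2 4 HeadEq = 6 := by
  rw [count_headEq_succ', count_two_all_three, count_two_headEq_three]

lemma count_two_all_four : count 2 4 (fun _ _ => True) = 26 := by
  rw [count_all four_pos, count_two_headEq_four, count_two_headLt_four]

/-- This solves E(N+1) = 2 E(N) + 2 L(N); the constant 2 persists because L carries a constant -1
and 2 · 2 - 2 = 2. -/
lemma count_two_headEq (n : ℕ) :
    count 2 (n + 5) HeadEq = (2 * n ^ 2 + 23 * n + 30) * 2 ^ n + 2 := by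
  induction n with
  | zero => rw [count_headEq_succ', count_two_all_four, count_two_headEq_four]; rfl
  | succ n ih =>
    have h := count_two_headLt_add_five n
    rw [count_headEq_succ', count_all (by omega), ih]
    have e : (2 * (n + 1) ^ 2 + 23 * (n + 1) + 30) * 2 ^ (n + 1) =
        2 * ((2 * n ^ 2 + 23 * n + 30) * 2 ^ n) + 2 * ((4 * n + 25) * 2 ^ n) := by ring
    omega

lemma count_two_all (n : ℕ) :
    count 2 (n + 5) (fun _ _ => True) = (2 * n ^ 2 + 31 * n + 80) * 2 ^ n := by
  have h := count_two_headLt_add_five n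
  rw [count_all (by omega), count_two_headEq]
  have e : (2 * n ^ 2 + 31 * n + 80) * 2 ^ n =
      (2 * n ^ 2 + 23 * n + 30) * 2 ^ n + 2 * ((4 * n + 25) * 2 ^ n) := by ring
  omega

theorem C_eq_count (K : Type*) [Field K] [CharZero K] {n : ℕ} (hn : 3 ≤ n) :
    C K n (n - 3) = count 2 n fun _ _ => True := by
  have hinj : Function.Injective fun p : Composition n × Composition n =>
      (p.1.blocks, p.2.blocks) := by
    rintro ⟨a, b⟩ ⟨a', b'⟩ h
    rw [Prod.mk.injEq] at h
    exact Prod.ext (Composition.ext h.1) (Composition.ext h.2)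
  have h : (fun p : Composition n × Composition n => (p.1.blocks, p.2.blocks)) ''
      {p | lieIndex K (seaweed K p.1 p.2) = n - 3} = pairs 2 n fun _ _ => True := by
    ext ⟨l, m⟩
    rw [Finset.mem_coe, mem_pairs]
    constructor
    · rintro ⟨⟨a, b⟩, hab, heq⟩
      obtain ⟨rfl, rfl⟩ := Prod.mk.inj heq
      exact ⟨Finset.mem_image_of_mem _ (Finset.mem_univ _),
        Finset.mem_image_of_mem _ (Finset.mem_univ _), (lieIndex_seaweed_eq_iff hn a b).mp hab,
        trivial⟩
    · rintro ⟨hl, hm, hD, -⟩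
      obtain ⟨a, -, rfl⟩ := Finset.mem_image.mp hl
      obtain ⟨b, -, rfl⟩ := Finset.mem_image.mp hm
      exact ⟨(a, b), (lieIndex_seaweed_eq_iff hn a b).mpr hD, rfl⟩
  rw [C, count, ← Set.ncard_image_of_injective _ hinj, h, Set.ncard_coe_finset]

end Seaweed

theorem mainTheorem2 (K : Type*) [Field K] [IsAlgClosed K] [CharZero K] (n : ℕ) (hn : 3 ≤ n) :
    (n ≤ 5 → (Seaweed.C K n (n - 3) : ℚ) = (7 * (n : ℚ) - 15) * 2 ^ (n - 3)) ∧
    (5 ≤ n → (Seaweed.C K n (n - 3) : ℚ) =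
      (1 / 2 * (n : ℚ) ^ 2 + 11 / 4 * (n : ℚ) - 25 / 4) * 2 ^ (n - 3)) := by
  rw [Seaweed.C_eq_count K hn]
  constructor
  · intro h
    interval_cases n
    · rw [Seaweed.count_two_all_three]; norm_num
    · rw [Seaweed.count_two_all_four]; norm_num
    -- n = 5 lies in both ranges, and both formulas give 80.
    · rw [Seaweed.count_two_all 0]; norm_num
  · intro h
    obtain ⟨m, rfl⟩ : ∃ m, n = m + 5 := ⟨n - 5, by omega⟩
    rw [Seaweed.count_two_all, Nat.add_sub_assoc (by norm_num)]
    push_cast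
    ring
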